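/- Notation. $d^c=\frac{i}{2\pi}(\bar\partial-\partial)$, so $dd^c=\frac{i}{\pi}\partial\bar\partial$; $B_1=\{\|z\|\le 1\}$ is the closed unit ball of $\mathbb C^k$; $\omega:=\frac12 dd^c\log(1+\|z\|^2)$ on $\mathbb C^k$. Let $\omega_{FS}$ be the Fubini–Study form on $\mathbb P^k$, equal to $\frac12dd^c\log(1+\|z\|^2)$ in each standard affine chart, let $\mathcal F$ be the set of quasi-plurisubharmonic functions $\phi:\mathbb P^k\to[-\infty,0]$ with $dd^c\phi\ge-\omega_{FS}$ and $\max_{\mathbb P^k}\phi=0$, and let $\mathcal F_0=\{\phi\circ\theta^{-1}:\phi\in\mathcal F\}$, where $\theta^{-1}(z)=[1:z_1:\dots:z_k]$. A positive measure $\mu$ on an open set $U\subset\mathbb C^k$ is called $(c,\alpha)$-moderate on $U$ (with $c,\alpha>0$) if $\int_U e^{-\alpha\phi}\,d\mu\le c$ for all $\phi\in\mathcal F_0$. Lemma. For every $R>1$ there are constants $c_1,c_2>0$, depending only on $R$, such that the following holds for every $k\ge1$, every open set $U\subset\mathbb C^k$ containing the ball $\{\|z\|<R\}$, every $0<\rho<1$,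 every $\epsilon$, and all $c,\alpha>0$. Let $u:U\to\mathbb R$ satisfy $|u(x)-u(y)|\le\epsilon\|x-y\|^\rho$ for all $x,y\in U$ and $dd^cu\ge0$ on $U$ in the sense of currents. Let $T$ be a positive closed $(k-1,k-1)$-current on $U$ such that the measure $T\wedge\omega$ is $(c,\alpha)$-moderate on $U$. Then $dd^c(uT)$ is a positive measure on $U$ and $$\int_{B_1}\exp\Bigl(-\frac{\alpha\rho}{4}\phi\Bigr)\,dd^c(uT)\le c\,k\,\epsilon\Bigl(c_1e^{\alpha}+\frac{c_2}{\alpha}\Bigr)\qquad\text{for all }\phi\in\mathcal F_0 .$$ -/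

import Mathlib

open Set Filter Topology MeasureTheory TopologicalSpace
open scoped ENNReal ContDiff Distributions LinearAlgebra.Projectivization

noncomputable section

namespace Moderate

/-- The complex Euclidean space `ℂᵏ`. -/
abbrev Cn (k : ℕ) : Type := EuclideanSpace ℂ (Fin k)

/-- Real alternating `n`-forms on the real vector space underlying `ℂᵏ`. -/
abbrev Alt (k n : ℕ) : Type := Cn k [⋀^Fin n]→L[ℝ] ℝ

/-! ### The operators `d^c` and `dd^c` on smooth functions -/

/-- The complex structure `v ↦ i v` as a real-linear map. -/
def J (k : ℕ) : Cn k →L[ℝ] Cn k :=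
  (Complex.I • ContinuousLinearMap.id ℂ (Cn k)).restrictScalars ℝ

/-- `d^c g = (i / 2π) (∂̄ g - ∂ g) = -(1 / 2π) dg ∘ J` for a real function `g`. -/
def dc {k : ℕ} (g : Cn k → ℝ) (x : Cn k) : Alt k 1 :=
  ContinuousAlternatingMap.ofSubsingleton ℝ (Cn k) ℝ (0 : Fin 1)
    ((-(1 / (2 * Real.pi))) • (fderiv ℝ g x ∘L J k))

/-- `dd^c g = (i / π) ∂∂̄ g`, the exterior derivative of `d^c g`. -/
def ddc {k : ℕ} (g : Cn k → ℝ) : Cn k → Alt k 2 := extDeriv (dc g)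

/-- The form `ω = (1/2) dd^c log (1 + ‖z‖²)` on `ℂᵏ`. -/
def omega (k : ℕ) : Cn k → Alt k 2 := ddc fun z => 1 / 2 * Real.log (1 + ‖z‖ ^ 2)

lemma contDiff_extDeriv {k n : ℕ} {β : Cn k → Alt k n} (hβ : ContDiff ℝ ∞ β) :
    ContDiff ℝ ∞ (extDeriv β) := by
  have h := hβ.fderiv_right (m := ∞) (by simp)
  have h2 := ContinuousLinearMap.contDiff (𝕜 := ℝ) (E := Cn k →L[ℝ] Alt k n) (F := Alt k (n + 1))
    (n := ∞) (ContinuousAlternatingMap.alternatizeUncurryFinCLM (n := n) ℝ (Cn k) ℝ)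
  exact h2.comp h

lemma contDiff_dc {k : ℕ} {g : Cn k → ℝ} (hg : ContDiff ℝ ∞ g) : ContDiff ℝ ∞ (dc g) := by
  have h1 : ContDiff ℝ ∞ (fun x => (-(1 / (2 * Real.pi))) • (fderiv ℝ g x ∘L J k)) :=
    ((hg.fderiv_right (m := ∞) (by simp)).clm_comp contDiff_const).const_smul _
  exact (ContinuousAlternatingMap.ofSubsingletonLIE (𝕜 := ℝ) (E := Cn k) (F := ℝ)
    (0 : Fin 1)).contDiff.comp h1

lemma contDiff_ddc {k : ℕ} {g : Cn k → ℝ} (hg : ContDiff ℝ ∞ g) : ContDiff ℝ ∞ (ddc g) :=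
  contDiff_extDeriv (contDiff_dc hg)

lemma contDiff_omega (k : ℕ) : ContDiff ℝ ∞ (omega k) := by
  refine contDiff_ddc (contDiff_const.mul (ContDiff.log ?_ fun z => by positivity))
  exact contDiff_const.add (contDiff_norm_sq ℝ)

lemma tsupport_extDeriv_subset {k n : ℕ} (β : Cn k → Alt k n) :
    tsupport (extDeriv β) ⊆ tsupport β := by
  refine (tsupport_comp_subset
    (g := ContinuousAlternatingMap.alternatizeUncurryFinCLM (n := n) ℝ (Cn k) ℝ)
    (map_zero _) (fderiv ℝ β)).trans (tsupport_fderiv_subset ℝ)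

lemma tsupport_dc_subset {k : ℕ} (g : Cn k → ℝ) : tsupport (dc g) ⊆ tsupport g := by
  refine (closure_mono fun x hx => ?_ : tsupport (dc g) ⊆ tsupport (fderiv ℝ g)).trans
    (tsupport_fderiv_subset ℝ)
  intro h
  apply hx
  ext v
  simp [dc, h]

/-! ### Test forms -/

/-- The product `g η` of a smooth function and a smooth compactly supported form. -/
def smulTest {k n : ℕ} {U : Opens (Cn k)} (g : Cn k → ℝ) (hg : ContDiff ℝ ∞ g)
    (η : 𝓓(U, Alt k n)) : 𝓓(U, Alt k n) where
  toFun x := g x • η x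
  contDiff' := hg.smul η.contDiff
  hasCompactSupport' := η.hasCompactSupport.smul_left (f := g)
  tsupport_subset' := (tsupport_smul_subset_right g (η : Cn k → Alt k n)).trans η.tsupport_subset

/-- The product `f γ` of a test function and a smooth form. -/
def testSmul {k n : ℕ} {U : Opens (Cn k)} (f : 𝓓(U, ℝ)) (γ : Cn k → Alt k n)
    (hγ : ContDiff ℝ ∞ γ) : 𝓓(U, Alt k n) where
  toFun x := f x • γ x
  contDiff' := f.contDiff.smul hγ
  hasCompactSupport' := f.hasCompactSupport.smul_right
  tsupport_subset' := (tsupport_smul_subset_left f γ).trans f.tsupport_subset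

/-- The exterior derivative of a test form. -/
def dTest {k n : ℕ} {U : Opens (Cn k)} (β : 𝓓(U, Alt k n)) : 𝓓(U, Alt k (n + 1)) where
  toFun := extDeriv β
  contDiff' := contDiff_extDeriv β.contDiff
  hasCompactSupport' := β.hasCompactSupport.of_isClosed_subset (isClosed_tsupport _)
    (tsupport_extDeriv_subset β)
  tsupport_subset' := (tsupport_extDeriv_subset β).trans β.tsupport_subset

/-- The test form `dd^c f` of a test function `f`. -/
def ddcTest {k : ℕ} {U : Opens (Cn k)} (f : 𝓓(U, ℝ)) : 𝓓(U, Alt k 2) where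
  toFun := ddc f
  contDiff' := contDiff_ddc f.contDiff
  hasCompactSupport' := f.hasCompactSupport.of_isClosed_subset (isClosed_tsupport _)
    ((tsupport_extDeriv_subset _).trans (tsupport_dc_subset f))
  tsupport_subset' :=
    ((tsupport_extDeriv_subset _).trans (tsupport_dc_subset f)).trans f.tsupport_subset

/-! ### Currents of dimension two -/

/-- Real currents of degree `2k - 2` on an open set `U ⊆ ℂᵏ`: continuous linear functionals on
the space of smooth compactly supported real `2`-forms on `U`, with its usual topology. -/
abbrev Current {k : ℕ} (U : Opens (Cn k)) : Type := 𝓓(U, Alt k 2) →L[ℝ] ℝ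

/-- A real `2`-covector of type `(1,1)`, i.e. one which is invariant under `J`. -/
def IsOneOne {k : ℕ} (a : Alt k 2) : Prop :=
  ∀ v w : Cn k, a ![J k v, J k w] = a ![v, w]

/-- A positive `(1,1)`-covector: `a = i ∑ h_{jl} dz_j ∧ dz̄_l` with `h` positive semidefinite. -/
def IsPositiveCovector {k : ℕ} (a : Alt k 2) : Prop :=
  IsOneOne a ∧ ∀ v : Cn k, 0 ≤ a ![v, J k v]

/-- `T` has bidegree `(k-1,k-1)`: it vanishes on the real forms of type `(2,0) + (0,2)`, which are
the forms `η` such that `η(Jv, Jw) = -η(v, w)`. -/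
def HasBidegree {k : ℕ} {U : Opens (Cn k)} (T : Current U) : Prop :=
  ∀ η : 𝓓(U, Alt k 2), (∀ (x v w : Cn k), η x ![J k v, J k w] = -η x ![v, w]) → T η = 0

/-- Positivity of a `(k-1,k-1)`-current: it is nonnegative on positive `(1,1)`-test forms. -/
def IsPositive {k : ℕ} {U : Opens (Cn k)} (T : Current U) : Prop :=
  ∀ η : 𝓓(U, Alt k 2), (∀ x, IsPositiveCovector (η x)) → 0 ≤ T η

/-- `dT = 0`. -/
def IsClosedCurrent {k : ℕ} {U : Opens (Cn k)} (T : Current U) : Prop :=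
  ∀ β : 𝓓(U, Alt k 1), T (dTest β) = 0

/-- The distribution (current of bidegree `(k,k)`) `T ∧ ω`, acting by `f ↦ ⟨T, f ω⟩`. -/
def wedgeOmega {k : ℕ} {U : Opens (Cn k)} (T : Current U) (f : 𝓓(U, ℝ)) : ℝ :=
  T (testSmul f (omega k) (contDiff_omega k))

/-- The distribution (current of bidegree `(k,k)`) `dd^c S`, acting by `f ↦ ⟨S, dd^c f⟩`. -/
def ddcCurrent {k : ℕ} {U : Opens (Cn k)} (S : Current U) (f : 𝓓(U, ℝ)) : ℝ :=
  S (ddcTest f)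

/-- `S = u T`, for `T` a current of order zero (such as a positive current) on `U` and `u`
continuous on `U`: the pairing `⟨S, η⟩ = ⟨T, u η⟩` is the limit of `⟨T, u_n η⟩` for all smooth
`u_n` converging to `u` locally uniformly on `U`. -/
def IsProduct {k : ℕ} {U : Opens (Cn k)} (u : Cn k → ℝ) (T S : Current U) : Prop :=
  ∀ (un : ℕ → Cn k → ℝ) (hun : ∀ n, ContDiff ℝ ∞ (un n)),
    TendstoLocallyUniformlyOn un u atTop (U : Set (Cn k)) →
      ∀ η : 𝓓(U, Alt k 2), Tendsto (fun n => T (smulTest (un n) (hun n) η)) atTop (𝓝 (S η))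

/-- The distribution `L` on `U` is the positive Radon measure `μ` (only the restriction of `μ`
to `U` matters). -/
def IsMeasureOf {k : ℕ} {U : Opens (Cn k)} (L : 𝓓(U, ℝ) → ℝ) (μ : Measure (Cn k)) : Prop :=
  (∀ K : Set (Cn k), IsCompact K → K ⊆ U → μ K < ⊤) ∧ ∀ f : 𝓓(U, ℝ), ∫ x, f x ∂μ = L f

/-! ### Plurisubharmonic functions and the class `𝓕` -/

/-- `dd^c u ≥ 0` on `U` in the sense of currents, for `u` locally integrable on `U`: tested against
`f · i α₂ ∧ ᾱ₂ ∧ ⋯ ∧ i α_k ∧ ᾱ_k`, where `f ≥ 0` is a test function and the `α_j` are independent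
covectors of type `(1,0)` with common kernel `ℂ v`, it says that the distribution
`(dd^c u)(v, Jv)` is nonnegative. -/
def DdcNonneg {k : ℕ} (U : Opens (Cn k)) (u : Cn k → ℝ) : Prop :=
  ∀ f : 𝓓(U, ℝ), (∀ x, 0 ≤ f x) → ∀ v : Cn k, 0 ≤ ∫ x, u x * ddc f x ![v, J k v]

/-- Plurisubharmonic functions `ℂᵏ → [-∞, ∞)`: upper semicontinuous, locally integrable, and
with the sub-mean value property on all closed complex discs `{a + ζ b : |ζ| ≤ 1}`. The mean value
over the circle is `-∞` unless the function is integrable there, so the inequality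
says something only if `g a ≠ -∞`, and then contains integrability. -/
def IsPsh {k : ℕ} (g : Cn k → EReal) : Prop :=
  UpperSemicontinuous g ∧ (∀ z, g z ≠ ⊤) ∧
  (∀ᵐ z, g z ≠ ⊥) ∧ LocallyIntegrable (fun z => (g z).toReal) ∧
  ∀ a b : Cn k, g a ≠ ⊥ →
    (∀ᵐ t : ℝ, g (a + circleMap 0 1 t • b) ≠ ⊥) ∧
    CircleIntegrable (fun ζ : ℂ => (g (a + ζ • b)).toReal) 0 1 ∧
    (g a).toReal ≤ Real.circleAverage (fun ζ : ℂ => (g (a + ζ • b)).toReal) 0 1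

/-- The projective space `ℙᵏ`. -/
abbrev Pn (k : ℕ) : Type := ℙ ℂ (Fin (k + 1) → ℂ)

/-- The point `[z₀ : ⋯ : 1 : ⋯ : z_{k-1}]` of `ℙᵏ`, with `1` in position `j`: the inverse of the
`j`-th affine chart. For `j = 0` it is `θ⁻¹ z = [1 : z]`. -/
def affinePoint {k : ℕ} (j : Fin (k + 1)) (z : Cn k) : Pn k :=
  Projectivization.mk ℂ (j.insertNth (α := fun _ => ℂ) (1 : ℂ) (fun i => z i))
    (fun h => one_ne_zero (α := ℂ) (by simpa using congrFun h j))

/-- The class `𝓕` of functions `φ` on `ℙᵏ` with `dd^c φ ≥ -ω_FS` and `max φ = 0`. In each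
affine chart `ω_FS = dd^c ((1/2) log (1 + ‖z‖²))`, so the first condition says that
`φ + (1/2) log (1 + ‖z‖²)` is plurisubharmonic in each chart. -/
def classF (k : ℕ) : Set (Pn k → EReal) :=
  {φ | (∀ j : Fin (k + 1),
      IsPsh fun z : Cn k => φ (affinePoint j z) + ((1 / 2 * Real.log (1 + ‖z‖ ^ 2) : ℝ) : EReal)) ∧
    IsGreatest (range φ) 0}

/-- The class `𝓕₀` of functions `φ ∘ θ⁻¹`, `φ ∈ 𝓕`. -/
def classF₀ (k : ℕ) : Set (Cn k → EReal) :=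
  {ψ | ∃ φ ∈ classF k, ψ = fun z => φ (affinePoint 0 z)}

/-- `μ` is `(c, α)`-moderate on `U`: `∫_U exp (-α φ) dμ ≤ c` for all `φ ∈ 𝓕₀`. -/
def IsModerateOn {k : ℕ} (U : Set (Cn k)) (μ : Measure (Cn k)) (c α : ℝ) : Prop :=
  ∀ φ ∈ classF₀ k, ∫⁻ z in U, EReal.exp (((-α : ℝ) : EReal) * φ z) ∂μ ≤ ENNReal.ofReal c

end Moderate

end

open Moderate

/-!
The estimate measures how much mass `dd^c (uT)` carries on the set `φ < -M`, for `φ` in the class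
`𝓕₀`, and sums the result over a sequence of levels `M`.

All inequalities between `(1,1)`-forms are stated through the Levi form
`levi f x v = D²f(v, v) + D²f(Jv, Jv)`, which is `2π` times the value of `dd^c f` on `(v, Jv)`. A
positive current is monotone with respect to them (`IsPositive.mono`), hence of order zero
(`exists_order_zero_bound`), so that the product `S = uT` exists as a limit (`exists_isProduct`).
For closed `T`, two integrations by parts give `⟨T, g dd^c f⟩ = ⟨T, f dd^c g⟩`
(`apply_smulTest_ddcTest`). Applied to mollifications of `u` it shows that `dd^c (uT)` is a positive
distribution (`ddcCurrent_nonneg`), and hence a measure (`exists_isMeasureOf`).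

By mollification of the plurisubharmonic function `φ + (1/2) log (1 + ‖z‖²)`, the functions of `𝓕₀`
are limits of smooth functions `φ ≤ 0` with `dd^c φ ≥ -ω` (`exists_regularization`), and Fatou's
lemma reduces the claim to these. For smooth `φ` the indicator function of `φ < -M` is replaced by
the logistic function `h = 1 / (1 + e^{α (φ + M)})`. It is at most `e^{-α M} e^{-α φ}`, and
`±dd^c h` is at most `α (dd^c σ + ω)`, where `σ` is a smooth substitute for `max φ (-M)` with
`dd^c σ ≥ -ω` (`abs_levi_logi_le`, `levi_softMax_add_nonneg`).

The function `u` is split at a scale `δ` as `w + (u - w)`, where `|u - w| ≤ 2 ε δ^ρ` and `w` is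
smooth with second derivatives at most `2 ε δ^(ρ - 2)` (`exists_semiconcave_approx`). The infimal
convolution is used for `w` since this bound, unlike that for a mollification, does not depend on
the dimension, and since only an upper bound is needed. With a radial cutoff function, integration
by parts and the moderateness of `T ∧ ω`, the pairing of `dd^c (uT)` with `h` is at most a multiple
of `c ε (δ^(ρ - 2) e^{-α M} + δ^ρ (1 + α))` (`exists_ddcCurrent_logi_le`). For `M = 4n / (αρ)` and
`δ = e^{-2n/ρ}` this is of size `e^{-2n}`, while `e^{-αρφ/4}` is of size `e^n` at the level `-M`, so
that the sum over `n` converges geometrically (`exists_lintegral_exp_le`). The constants do not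
depend on `k`, and `2 + α ≤ 2 e^α`.
-/

namespace Moderate

/-! ### The Levi form of a smooth function -/

/-- The Levi form of `f` at `x`, up to a factor: `D²f(v, v) + D²f(Jv, Jv)`. It is `2π` times
the value of `dd^c f` on `(v, Jv)`. -/
noncomputable def levi {k : ℕ} (f : Cn k → ℝ) (x v : Cn k) : ℝ :=
  fderiv ℝ (fderiv ℝ f) x v v + fderiv ℝ (fderiv ℝ f) x (J k v) (J k v)

/-- `df(v)² + df(Jv)²`, which is `2π` times the value of `df ∧ d^c f` on `(v, Jv)`. -/
noncomputable def gradSq {k : ℕ} (f : Cn k → ℝ) (x v : Cn k) : ℝ :=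
  fderiv ℝ f x v ^ 2 + fderiv ℝ f x (J k v) ^ 2

lemma J_apply {k : ℕ} (v : Cn k) : J k v = Complex.I • v := rfl

lemma J_J {k : ℕ} (v : Cn k) : J k (J k v) = -v := by
  simp [J_apply, smul_smul]

lemma norm_J {k : ℕ} (v : Cn k) : ‖J k v‖ = ‖v‖ := by
  simp [J_apply, norm_smul]

lemma gradSq_nonneg {k : ℕ} (f : Cn k → ℝ) (x v : Cn k) : 0 ≤ gradSq f x v := by
  unfold gradSq; positivity

section Smooth

variable {k : ℕ} {f g : Cn k → ℝ}

lemma differentiable_of_smooth (hf : ContDiff ℝ ∞ f) : Differentiable ℝ f :=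
  hf.differentiable (by simp)

lemma contDiff_fderiv_of_smooth (hf : ContDiff ℝ ∞ f) : ContDiff ℝ ∞ (fderiv ℝ f) :=
  hf.fderiv_right (m := ∞) (by simp)

lemma differentiable_fderiv_of_smooth (hf : ContDiff ℝ ∞ f) : Differentiable ℝ (fderiv ℝ f) :=
  (contDiff_fderiv_of_smooth hf).differentiable (by simp)

lemma fderiv_fderiv_symm (hf : ContDiff ℝ ∞ f) (x v w : Cn k) :
    fderiv ℝ (fderiv ℝ f) x v w = fderiv ℝ (fderiv ℝ f) x w v :=
  ((contDiff_infty.1 hf 2).contDiffAt.isSymmSndFDerivAt (by simp)).eq v w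

lemma dc_apply (f : Cn k → ℝ) (x : Cn k) (v : Fin 1 → Cn k) :
    dc f x v = -(1 / (2 * Real.pi)) * fderiv ℝ f x (J k (v 0)) := by
  simp [dc]

/-- The exterior derivative of a `1`-form. -/
lemma extDeriv_one_apply {β : Cn k → Alt k 1} {x : Cn k} (h : DifferentiableAt ℝ β x)
    (v w : Cn k) :
    extDeriv β x ![v, w] = fderiv ℝ (fun y => β y ![w]) x v - fderiv ℝ (fun y => β y ![v]) x w := by
  have h0 : (0 : Fin 2).removeNth ![v, w] = ![w] := by
    ext i; fin_cases i; rfl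
  have h1 : (1 : Fin 2).removeNth ![v, w] = ![v] := by
    ext i; fin_cases i; rfl
  refine (extDeriv_apply h _).trans ((Fin.sum_univ_two _).trans ?_)
  rw [h0, h1]
  simp [sub_eq_add_neg]

lemma fderiv_dc_apply (hf : ContDiff ℝ ∞ f) (x v w : Cn k) :
    fderiv ℝ (fun y => dc f y ![w]) x v
      = -(1 / (2 * Real.pi)) * fderiv ℝ (fderiv ℝ f) x v (J k w) := by
  have h := ((differentiable_fderiv_of_smooth hf x).hasFDerivAt.clm_apply
    (hasFDerivAt_const (J k w) x)).const_mul (-(1 / (2 * Real.pi)))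
  have e : (fun y => dc f y ![w]) = fun y => -(1 / (2 * Real.pi)) * fderiv ℝ f y (J k w) := by
    ext y; simp [dc_apply]
  rw [e, h.fderiv]
  simp

lemma ddc_apply (hf : ContDiff ℝ ∞ f) (x v w : Cn k) :
    ddc f x ![v, w] = -(1 / (2 * Real.pi)) *
      (fderiv ℝ (fderiv ℝ f) x v (J k w) - fderiv ℝ (fderiv ℝ f) x w (J k v)) := by
  rw [ddc, extDeriv_one_apply ((contDiff_dc hf).differentiable (by simp) x),
    fderiv_dc_apply hf, fderiv_dc_apply hf]
  ring

lemma ddc_apply_J (hf : ContDiff ℝ ∞ f) (x v : Cn k) :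
    ddc f x ![v, J k v] = 1 / (2 * Real.pi) * levi f x v := by
  rw [ddc_apply hf, J_J, levi]
  simp only [map_neg]
  ring

lemma isOneOne_ddc (hf : ContDiff ℝ ∞ f) (x : Cn k) : IsOneOne (ddc f x) := by
  intro v w
  rw [ddc_apply hf, ddc_apply hf, J_J, J_J]
  simp only [map_neg]
  rw [fderiv_fderiv_symm hf x w, fderiv_fderiv_symm hf x _ v]
  ring

/-- The chain rule for the Levi form. -/
lemma levi_comp {q : ℝ → ℝ} (hq : ContDiff ℝ ∞ q) (hf : ContDiff ℝ ∞ f) (x v : Cn k) :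
    levi (fun y => q (f y)) x v
      = deriv q (f x) * levi f x v + deriv (deriv q) (f x) * gradSq f x v := by
  have hdq : ContDiff ℝ ∞ (deriv q) := (contDiff_infty_iff_deriv.1 hq).2
  have e : fderiv ℝ (fun y => q (f y)) = fun y => deriv q (f y) • fderiv ℝ f y := by
    ext1 y
    exact ((hq.differentiable (by simp) (f y)).hasDerivAt.comp_hasFDerivAt y
      (differentiable_of_smooth hf y).hasFDerivAt).fderiv
  have h2 := ((hdq.differentiable (by simp) (f x)).hasDerivAt.comp_hasFDerivAt x
      (differentiable_of_smooth hf x).hasFDerivAt).smul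
      (differentiable_fderiv_of_smooth hf x).hasFDerivAt
  have h3 : fderiv ℝ (fun y => deriv q (f y) • fderiv ℝ f y) x = _ := h2.fderiv
  rw [levi, e, h3, levi, gradSq]
  simp
  ring

lemma gradSq_comp {q : ℝ → ℝ} (hq : ContDiff ℝ ∞ q) (hf : ContDiff ℝ ∞ f) (x v : Cn k) :
    gradSq (fun y => q (f y)) x v = deriv q (f x) ^ 2 * gradSq f x v := by
  have e : fderiv ℝ (fun y => q (f y)) x = deriv q (f x) • fderiv ℝ f x :=
    ((hq.differentiable (by simp) (f x)).hasDerivAt.comp_hasFDerivAt x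
      (differentiable_of_smooth hf x).hasFDerivAt).fderiv
  rw [gradSq, gradSq, e]
  simp
  ring

/-- The product rule for the Levi form. -/
lemma levi_mul (hf : ContDiff ℝ ∞ f) (hg : ContDiff ℝ ∞ g) (x v : Cn k) :
    levi (fun y => f y * g y) x v = f x * levi g x v + g x * levi f x v
      + 2 * (fderiv ℝ f x v * fderiv ℝ g x v + fderiv ℝ f x (J k v) * fderiv ℝ g x (J k v)) := by
  have e : fderiv ℝ (fun y => f y * g y) = fun y => f y • fderiv ℝ g y + g y • fderiv ℝ f y := by
    ext1 y
    exact ((differentiable_of_smooth hf y).hasFDerivAt.mul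
      (differentiable_of_smooth hg y).hasFDerivAt).fderiv
  have h2 := ((differentiable_of_smooth hf x).hasFDerivAt.smul
      (differentiable_fderiv_of_smooth hg x).hasFDerivAt).add
      ((differentiable_of_smooth hg x).hasFDerivAt.smul
      (differentiable_fderiv_of_smooth hf x).hasFDerivAt)
  have h3 : fderiv ℝ (fun y => f y • fderiv ℝ g y + g y • fderiv ℝ f y) x = _ := h2.fderiv
  rw [levi, e, h3, levi, levi]
  simp
  ring

lemma levi_add (hf : ContDiff ℝ ∞ f) (hg : ContDiff ℝ ∞ g) (x v : Cn k) :
    levi (fun y => f y + g y) x v = levi f x v + levi g x v := by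
  have e : fderiv ℝ (fun y => f y + g y) = fun y => fderiv ℝ f y + fderiv ℝ g y := by
    ext1 y
    exact fderiv_fun_add (differentiable_of_smooth hf y) (differentiable_of_smooth hg y)
  have h3 : fderiv ℝ (fun y => fderiv ℝ f y + fderiv ℝ g y) x = _ :=
    fderiv_fun_add (differentiable_fderiv_of_smooth hf x) (differentiable_fderiv_of_smooth hg x)
  rw [levi, e, h3, levi, levi]
  simp
  ring

lemma levi_sub_const (f : Cn k → ℝ) (c : ℝ) (x v : Cn k) :
    levi (fun y => f y - c) x v = levi f x v := by
  have e : fderiv ℝ (fun y => f y - c) = fderiv ℝ f := by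
    ext1 y
    exact fderiv_sub_const c
  rw [levi, e, levi]

lemma levi_sub (hf : ContDiff ℝ ∞ f) (hg : ContDiff ℝ ∞ g) (x v : Cn k) :
    levi (fun y => f y - g y) x v = levi f x v - levi g x v := by
  have h := levi_add (f := fun y => f y - g y) (hf.sub hg) hg x v
  simp only [sub_add_cancel] at h
  have : levi (fun y => f y) x v = levi f x v := rfl
  linarith

/-- The polarized terms in the product rule are controlled by `gradSq`. -/
lemma abs_cross_le (f g : Cn k → ℝ) (x v : Cn k) :
    |2 * (fderiv ℝ f x v * fderiv ℝ g x v + fderiv ℝ f x (J k v) * fderiv ℝ g x (J k v))|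
      ≤ gradSq f x v + gradSq g x v := by
  unfold gradSq
  rw [abs_le]
  constructor <;> nlinarith [sq_nonneg (fderiv ℝ f x v + fderiv ℝ g x v),
    sq_nonneg (fderiv ℝ f x v - fderiv ℝ g x v),
    sq_nonneg (fderiv ℝ f x (J k v) + fderiv ℝ g x (J k v)),
    sq_nonneg (fderiv ℝ f x (J k v) - fderiv ℝ g x (J k v))]

end Smooth

/-! ### Radial functions and the form `ω` -/

section Radial

variable {k : ℕ}

lemma contDiff_normSq : ContDiff ℝ ∞ (fun x : Cn k => ‖x‖ ^ 2) := contDiff_norm_sq ℝ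

lemma fderiv_normSq (x v : Cn k) :
    fderiv ℝ (fun x : Cn k => ‖x‖ ^ 2) x v = 2 * inner ℝ x v := by
  simp

lemma fderiv_fderiv_normSq (x v w : Cn k) :
    fderiv ℝ (fderiv ℝ (fun x : Cn k => ‖x‖ ^ 2)) x v w = 2 * inner ℝ v w := by
  have e : fderiv ℝ (fun x : Cn k => ‖x‖ ^ 2) = (2 : ℝ) • innerSL ℝ := by
    ext y w
    simp
  rw [e, ContinuousLinearMap.fderiv]
  simp only [smul_apply, smul_eq_mul]
  rfl

lemma levi_normSq (x v : Cn k) : levi (fun x : Cn k => ‖x‖ ^ 2) x v = 4 * ‖v‖ ^ 2 := by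
  rw [levi, fderiv_fderiv_normSq, fderiv_fderiv_normSq, real_inner_self_eq_norm_sq,
    real_inner_self_eq_norm_sq, norm_J]
  ring

lemma inner_J_right (x v : Cn k) : inner ℝ x (J k v) = -(inner ℂ x v).im := by
  have h : inner ℝ x (J k v) = (inner ℂ x (J k v)).re := by
    simp [PiLp.inner_apply, Complex.inner]
  rw [h, J_apply, inner_smul_right]
  simp

lemma inner_sq_add_inner_J_sq_le (x v : Cn k) :
    inner ℝ x v ^ 2 + inner ℝ x (J k v) ^ 2 ≤ ‖x‖ ^ 2 * ‖v‖ ^ 2 := by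
  have h : inner ℝ x v = (inner ℂ x v).re := by
    simp [PiLp.inner_apply, Complex.inner]
  rw [inner_J_right, h, ← mul_pow]
  have h2 : ‖inner ℂ x v‖ ^ 2 ≤ (‖x‖ * ‖v‖) ^ 2 := by
    gcongr
    exact norm_inner_le_norm x v
  rw [Complex.sq_norm, Complex.normSq_apply] at h2
  nlinarith

lemma gradSq_normSq_le (x v : Cn k) :
    gradSq (fun x : Cn k => ‖x‖ ^ 2) x v ≤ 4 * ‖x‖ ^ 2 * ‖v‖ ^ 2 := by
  rw [gradSq, fderiv_normSq, fderiv_normSq]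
  nlinarith [inner_sq_add_inner_J_sq_le x v]

/-- A bound for the Levi form of a radial function by the bounds on its profile. -/
lemma abs_levi_radial_le {q : ℝ → ℝ} (hq : ContDiff ℝ ∞ q) {A B b : ℝ} (x v : Cn k)
    (hx : ‖x‖ ^ 2 ≤ b) (h1 : |deriv q (‖x‖ ^ 2)| ≤ A) (h2 : |deriv (deriv q) (‖x‖ ^ 2)| ≤ B) :
    |levi (fun y : Cn k => q (‖y‖ ^ 2)) x v| ≤ (4 * A + 4 * B * b) * ‖v‖ ^ 2 := by
  have hb : 0 ≤ b := (sq_nonneg _).trans hx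
  rw [levi_comp hq contDiff_normSq, levi_normSq]
  have h3 : |deriv q (‖x‖ ^ 2) * (4 * ‖v‖ ^ 2)| ≤ A * (4 * ‖v‖ ^ 2) := by
    rw [abs_mul, abs_of_nonneg (a := 4 * ‖v‖ ^ 2) (by positivity)]
    gcongr
  have h4 : |deriv (deriv q) (‖x‖ ^ 2) * gradSq (fun y : Cn k => ‖y‖ ^ 2) x v|
      ≤ B * (4 * b * ‖v‖ ^ 2) := by
    rw [abs_mul, abs_of_nonneg (gradSq_nonneg _ _ _)]
    have : gradSq (fun y : Cn k => ‖y‖ ^ 2) x v ≤ 4 * b * ‖v‖ ^ 2 :=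
      (gradSq_normSq_le x v).trans (by gcongr)
    have := gradSq_nonneg (fun y : Cn k => ‖y‖ ^ 2) x v
    have := (abs_nonneg _).trans h2
    gcongr
  calc _ ≤ _ := abs_add_le _ _
    _ ≤ A * (4 * ‖v‖ ^ 2) + B * (4 * b * ‖v‖ ^ 2) := add_le_add h3 h4
    _ = _ := by ring

/-- The potential `(1/2) log (1 + ‖z‖²)` of `ω`. -/
noncomputable def pot (k : ℕ) (z : Cn k) : ℝ := 1 / 2 * Real.log (1 + ‖z‖ ^ 2)

lemma contDiff_pot (k : ℕ) : ContDiff ℝ ∞ (pot k) := by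
  refine contDiff_const.mul (ContDiff.log ?_ fun z => by positivity)
  exact contDiff_const.add (contDiff_norm_sq ℝ)

lemma omega_eq (k : ℕ) : omega k = ddc (pot k) := rfl

lemma levi_pot_ge (x v : Cn k) : 2 * ‖v‖ ^ 2 / (1 + ‖x‖ ^ 2) ^ 2 ≤ levi (pot k) x v := by
  -- `log (1 + s)` is smooth only for `s > -1`, so the chain rule is applied to the exponential
  -- of the potential
  have h1 : (fun y : Cn k => Real.exp (pot k y + pot k y)) = fun y => ‖y‖ ^ 2 - (-1) := by
    ext y
    rw [pot, ← two_mul, ← mul_assoc, mul_one_div_cancel two_ne_zero, one_mul,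
      Real.exp_log (by positivity)]
    ring
  have hs : ContDiff ℝ ∞ (fun y : Cn k => pot k y + pot k y) :=
    (contDiff_pot k).add (contDiff_pot k)
  have h2 := levi_comp Real.contDiff_exp hs x v
  have h3 := gradSq_comp Real.contDiff_exp hs x v
  rw [h1, levi_sub_const, levi_normSq, levi_add (contDiff_pot k) (contDiff_pot k)] at h2
  rw [h1] at h3
  have h4 : gradSq (fun y : Cn k => ‖y‖ ^ 2 - (-1)) x v = gradSq (fun y : Cn k => ‖y‖ ^ 2) x v := by
    simp only [gradSq, fderiv_sub_const]
  have h5 := gradSq_normSq_le x v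
  have h6 : Real.exp (pot k x + pot k x) = ‖x‖ ^ 2 + 1 := by
    have := congrFun h1 x
    simpa using this
  simp only [Real.deriv_exp, h6] at h2 h3
  rw [h4] at h3
  have hp : 0 < 1 + ‖x‖ ^ 2 := by positivity
  rw [div_le_iff₀ (by positivity)]
  nlinarith [mul_nonneg hp.le hp.le]

lemma omega_apply_J (x v : Cn k) :
    omega k x ![v, J k v] = 1 / (2 * Real.pi) * levi (pot k) x v := by
  rw [omega_eq, ddc_apply_J (contDiff_pot k)]

lemma omega_isOneOne (x : Cn k) : IsOneOne (omega k x) := isOneOne_ddc (contDiff_pot k) x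

lemma levi_pot_nonneg (x v : Cn k) : 0 ≤ levi (pot k) x v :=
  le_trans (by positivity) (levi_pot_ge x v)

lemma normSq_le_levi_pot {b : ℝ} (x v : Cn k) (hx : ‖x‖ ^ 2 ≤ b) :
    ‖v‖ ^ 2 ≤ (1 + b) ^ 2 / 2 * levi (pot k) x v := by
  have h := levi_pot_ge x v
  rw [div_le_iff₀ (by positivity)] at h
  have h2 : levi (pot k) x v * (1 + ‖x‖ ^ 2) ^ 2 ≤ levi (pot k) x v * (1 + b) ^ 2 := by
    have := levi_pot_nonneg x v
    gcongr
  linarith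

end Radial

/-! ### Positive closed currents -/

section Currents

variable {k : ℕ} {U : Opens (Cn k)}

lemma exists_cutoff {K : Set (Cn k)} (hK : IsCompact K) (hKU : K ⊆ U) :
    ∃ χ : 𝓓(U, ℝ), (∀ x, 0 ≤ χ x ∧ χ x ≤ 1) ∧ ∀ x ∈ K, χ x = 1 := by
  obtain ⟨K', hK', h1, h2⟩ := exists_compact_between hK U.isOpen hKU
  obtain ⟨f, hf0, hf1, hf⟩ := exists_contMDiffMap_zero_one_of_isClosed (n := ⊤)
    (modelWithCornersSelf ℝ (Cn k)) (isOpen_interior (s := K')).isClosed_compl hK.isClosed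
    (disjoint_left.2 fun x hx hx' => hx (h1 hx'))
  have hsupp : tsupport f ⊆ K' := by
    refine closure_minimal (fun x hx => ?_) hK'.isClosed
    by_contra hx'
    exact hx (hf0 fun h => hx' (interior_subset h))
  exact ⟨⟨f, f.contMDiff.contDiff, hK'.of_isClosed_subset (isClosed_tsupport _) hsupp,
    hsupp.trans h2⟩, fun x => hf x, fun x hx => hf1 hx⟩

@[simp] lemma smulTest_apply {n : ℕ} (g : Cn k → ℝ) (hg : ContDiff ℝ ∞ g) (η : 𝓓(U, Alt k n))
    (x : Cn k) : smulTest g hg η x = g x • η x := rfl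

@[simp] lemma testSmul_apply {n : ℕ} (f : 𝓓(U, ℝ)) (γ : Cn k → Alt k n) (hγ : ContDiff ℝ ∞ γ)
    (x : Cn k) : testSmul f γ hγ x = f x • γ x := rfl

@[simp] lemma dTest_apply {n : ℕ} (β : 𝓓(U, Alt k n)) (x : Cn k) :
    dTest β x = extDeriv β x := rfl

@[simp] lemma ddcTest_apply (f : 𝓓(U, ℝ)) (x : Cn k) : ddcTest f x = ddc f x := rfl

lemma IsOneOne.smul {a : Alt k 2} (ha : IsOneOne a) (c : ℝ) : IsOneOne (c • a) := by
  intro v w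
  simp [ha v w]

lemma IsOneOne.sub {a b : Alt k 2} (ha : IsOneOne a) (hb : IsOneOne b) : IsOneOne (a - b) := by
  intro v w
  simp [ha v w, hb v w]

lemma IsOneOne.add {a b : Alt k 2} (ha : IsOneOne a) (hb : IsOneOne b) : IsOneOne (a + b) := by
  intro v w
  simp [ha v w, hb v w]

/-- A positive current is monotone on the real forms of type `(1,1)`. -/
lemma IsPositive.mono {T : Current U} (hT : IsPositive T) {η θ : 𝓓(U, Alt k 2)}
    (hη : ∀ x, IsOneOne (η x)) (hθ : ∀ x, IsOneOne (θ x))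
    (h : ∀ x v, η x ![v, J k v] ≤ θ x ![v, J k v]) : T η ≤ T θ := by
  have h0 := hT (θ - η) fun x => ⟨(hθ x).sub (hη x), fun v => by
    simpa using h x v⟩
  rw [map_sub] at h0
  linarith

/-- If `±η ≤ θ` and `|g| ≤ s`, then `|⟨T, g η⟩| ≤ s ⟨T, θ⟩`. -/
lemma IsPositive.abs_smulTest_le {T : Current U} (hT : IsPositive T) {η θ : 𝓓(U, Alt k 2)}
    (hη : ∀ x, IsOneOne (η x)) (hθ : ∀ x, IsOneOne (θ x))
    (h : ∀ x v, |η x ![v, J k v]| ≤ θ x ![v, J k v]) {g : Cn k → ℝ} (hg : ContDiff ℝ ∞ g) {s : ℝ}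
    (hs : ∀ x, |g x| ≤ s) : |T (smulTest g hg η)| ≤ s * T θ := by
  have key : ∀ x v, |g x * η x ![v, J k v]| ≤ s * θ x ![v, J k v] := fun x v => by
    rw [abs_mul]
    exact mul_le_mul (hs x) (h x v) (abs_nonneg _) ((abs_nonneg _).trans (hs x))
  have e : s * T θ = T (s • θ) := by simp
  have hsθ : ∀ x, IsOneOne ((s • θ) x) := fun x => (hθ x).smul s
  have hgη : ∀ x, IsOneOne (smulTest g hg η x) := fun x => (hη x).smul (g x)
  rw [e, abs_le, neg_le, ← map_neg]
  constructor
  · refine hT.mono (fun x => ?_) hsθ fun x v => ?_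
    · change IsOneOne (-(smulTest g hg η x))
      rw [← neg_one_smul ℝ]
      exact (hgη x).smul (-1)
    · have := (abs_le.1 (key x v)).1
      simp only [smulTest_apply, neg_apply, smul_apply, smul_eq_mul,
        ContinuousAlternatingMap.smul_apply, ContinuousAlternatingMap.neg_apply]
      linarith
  · refine hT.mono hgη hsθ fun x v => ?_
    have := (abs_le.1 (key x v)).2
    simpa using this

/-- The part of type `(1,1)` of a real `2`-form. -/
noncomputable def oneOnePart (η : 𝓓(U, Alt k 2)) : 𝓓(U, Alt k 2) :=
  (1 / 2 : ℝ) • (η + TestFunction.postcompCLM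
    (ContinuousAlternatingMap.compContinuousLinearMapCLM (J k)) η)

lemma oneOnePart_apply (η : 𝓓(U, Alt k 2)) (x v w : Cn k) :
    oneOnePart η x ![v, w] = 1 / 2 * (η x ![v, w] + η x ![J k v, J k w]) := by
  have e : (J k) ∘ ![v, w] = ![J k v, J k w] := by
    ext1 i; fin_cases i <;> rfl
  simp [oneOnePart, TestFunction.postcompCLM_apply, e]
  ring

lemma alt_swap (a : Alt k 2) (v w : Cn k) : a ![w, v] = -a ![v, w] := by
  have h := a.toAlternatingMap.map_swap ![v, w] (i := 0) (j := 1) (by simp)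
  have e : ![v, w] ∘ (Equiv.swap (0 : Fin 2) 1) = ![w, v] := by
    ext1 i; fin_cases i <;> rfl
  rw [e] at h
  exact h

lemma alt_neg_left (a : Alt k 2) (v w : Cn k) : a ![-v, w] = -a ![v, w] := by
  have h := a.toMultilinearMap.map_update_smul ![v, w] 0 (-1 : ℝ) v
  have e : ∀ z, Function.update ![v, w] 0 z = ![z, w] := fun z => by
    ext1 i; fin_cases i <;> rfl
  rw [e, e, neg_one_smul, neg_one_smul] at h
  exact h

lemma alt_neg_right (a : Alt k 2) (v w : Cn k) : a ![v, -w] = -a ![v, w] := by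
  rw [alt_swap a (-w) v, alt_neg_left, alt_swap a v w, neg_neg]

lemma isOneOne_oneOnePart (η : 𝓓(U, Alt k 2)) (x : Cn k) : IsOneOne (oneOnePart η x) := by
  intro v w
  simp only [oneOnePart_apply, J_J, alt_neg_left, alt_neg_right]
  ring

lemma oneOnePart_apply_J (η : 𝓓(U, Alt k 2)) (x v : Cn k) :
    oneOnePart η x ![v, J k v] = η x ![v, J k v] := by
  rw [oneOnePart_apply, J_J, alt_neg_right, alt_swap (η x) v]
  ring

lemma HasBidegree.apply_oneOnePart {T : Current U} (hT : HasBidegree T) (η : 𝓓(U, Alt k 2)) :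
    T (oneOnePart η) = T η := by
  have h := hT (η - oneOnePart η) fun x v w => by
    simp only [sub_apply, ContinuousAlternatingMap.sub_apply, oneOnePart_apply, J_J, alt_neg_left,
      alt_neg_right]
    ring
  rw [map_sub] at h
  linarith

/-- A positive current has order zero: on the forms supported in a given compact set it is
bounded by a multiple of the uniform norm, because multiples of the strictly positive form `ω`
dominate the `(1,1)`-parts of these forms. -/
lemma exists_order_zero_bound {T : Current U} (hb : HasBidegree T) (hT : IsPositive T)
    {K : Set (Cn k)} (hK : IsCompact K) (hKU : K ⊆ U) :
    ∃ C : ℝ, 0 ≤ C ∧ ∀ (η : 𝓓(U, Alt k 2)) (B : ℝ), (∀ x, x ∉ K → η x = 0) → (∀ x, ‖η x‖ ≤ B) →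
      |T η| ≤ C * B := by
  obtain ⟨χ, hχ, hχ1⟩ := exists_cutoff hK hKU
  obtain ⟨r, hr⟩ := hK.isBounded.exists_norm_le
  set D : ℝ := (1 + r ^ 2) ^ 2 / 2 * (2 * Real.pi)
  set θ := testSmul χ (omega k) (contDiff_omega k)
  have hD : 0 ≤ D := by positivity
  have hω : ∀ x v : Cn k, 0 ≤ omega k x ![v, J k v] := fun x v => by
    rw [omega_apply_J]
    have := levi_pot_nonneg x v
    positivity
  have hθ1 : ∀ x, IsOneOne (θ x) := fun x => (omega_isOneOne x).smul _
  have hθ0 : 0 ≤ T θ := hT θ fun x => ⟨hθ1 x, fun v => by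
    have := mul_nonneg (hχ x).1 (hω x v)
    simpa [θ] using this⟩
  refine ⟨D * T θ, by positivity, fun η B hηK hηB => ?_⟩
  have hB : 0 ≤ B := (norm_nonneg _).trans (hηB 0)
  have key : ∀ x v : Cn k, |oneOnePart η x ![v, J k v]| ≤ ((B * D) • θ) x ![v, J k v] := by
    intro x v
    have e : ((B * D) • θ) x ![v, J k v] = B * D * (χ x * omega k x ![v, J k v]) := by
      simp [θ]
    rw [oneOnePart_apply_J, e]
    by_cases hx : x ∈ K
    · rw [hχ1 x hx, one_mul]
      have h1 : |η x ![v, J k v]| ≤ ‖η x‖ * (‖v‖ * ‖J k v‖) := by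
        have := (η x).le_opNorm ![v, J k v]
        simpa [Fin.prod_univ_two] using this
      rw [norm_J] at h1
      have h2 : ‖v‖ ^ 2 ≤ D * omega k x ![v, J k v] := by
        have h3 : ‖x‖ ^ 2 ≤ r ^ 2 := by
          have := hr x hx
          gcongr
        have h4 := normSq_le_levi_pot x v h3
        rw [omega_apply_J]
        refine h4.trans_eq ?_
        simp only [D]
        field_simp
      calc _ ≤ _ := h1
        _ ≤ B * (D * omega k x ![v, J k v]) := by
          rw [← sq]
          have := hηB x
          gcongr
        _ = _ := by ring
    · rw [hηK x hx]
      have := hω x v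
      have := (hχ x).1
      have h0 : |(0 : Alt k 2) ![v, J k v]| = 0 := by simp
      rw [h0]
      positivity
  have h1 : ∀ x, IsOneOne (((B * D) • θ) x) := fun x => (hθ1 x).smul _
  have h := hT.abs_smulTest_le (isOneOne_oneOnePart η) h1 key
    (contDiff_const (c := (1 : ℝ))) (s := 1) (by simp)
  have e1 : smulTest (fun _ : Cn k => (1 : ℝ)) contDiff_const (oneOnePart η) = oneOnePart η := by
    ext1 x; simp
  rw [e1, hb.apply_oneOnePart, map_smul, smul_eq_mul] at h
  linarith

/-- The test form `d^c f` of a test function `f`. -/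
noncomputable def dcTest (f : 𝓓(U, ℝ)) : 𝓓(U, Alt k 1) where
  toFun := dc f
  contDiff' := contDiff_dc f.contDiff
  hasCompactSupport' := f.hasCompactSupport.of_isClosed_subset (isClosed_tsupport _)
    (tsupport_dc_subset f)
  tsupport_subset' := (tsupport_dc_subset f).trans f.tsupport_subset

@[simp] lemma dcTest_apply (f : 𝓓(U, ℝ)) (x : Cn k) : dcTest f x = dc f x := rfl

lemma fderiv_mul_dc_apply {f g : Cn k → ℝ} (hf : ContDiff ℝ ∞ f) (hg : ContDiff ℝ ∞ g)
    (x v w : Cn k) : fderiv ℝ (fun y => g y * dc f y ![w]) x v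
      = g x * fderiv ℝ (fun y => dc f y ![w]) x v + dc f x ![w] * fderiv ℝ g x v := by
  have h1 : DifferentiableAt ℝ (fun y => dc f y ![w]) x := by
    have e : (fun y => dc f y ![w]) = fun y => -(1 / (2 * Real.pi)) * fderiv ℝ f y (J k w) := by
      ext y; simp [dc_apply]
    rw [e]
    exact ((differentiable_fderiv_of_smooth hf x).clm_apply
      (differentiableAt_const _)).const_mul _
  have h2 := ((differentiable_of_smooth hg x).hasFDerivAt.mul h1.hasFDerivAt).fderiv
  have h3 : fderiv ℝ (fun y => g y * dc f y ![w]) x = _ := h2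
  rw [h3]
  simp

/-- Integration by parts: `⟨T, g dd^c f⟩ = ⟨T, f dd^c g⟩` for a closed current of bidegree
`(k-1,k-1)`. The form `g dd^c f - f dd^c g` differs from `d (g d^c f - f d^c g)` by
`dg ∧ d^c f - df ∧ d^c g`, which has no part of type `(1,1)`. -/
lemma apply_smulTest_ddcTest {T : Current U} (hb : HasBidegree T) (hc : IsClosedCurrent T)
    {g : Cn k → ℝ} (hg : ContDiff ℝ ∞ g) (f : 𝓓(U, ℝ)) :
    T (smulTest g hg (ddcTest f)) = T (testSmul f (ddc g) (contDiff_ddc hg)) := by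
  set β : 𝓓(U, Alt k 1) := smulTest g hg (dcTest f) - testSmul f (dc g) (contDiff_dc hg)
  have hβ : ∀ x v w : Cn k, extDeriv β x ![v, w]
      = g x * ddc f x ![v, w] - f x * ddc g x ![v, w]
        + (dc f x ![w] * fderiv ℝ g x v - dc f x ![v] * fderiv ℝ g x w)
        - (dc g x ![w] * fderiv ℝ f x v - dc g x ![v] * fderiv ℝ f x w) := by
    intro x v w
    have e : ∀ z : Cn k, ∀ y, β y ![z] = g y * dc f y ![z] - f y * dc g y ![z] := fun z y => by
      simp [β]
    have hd : ∀ {f g : Cn k → ℝ} (hf : ContDiff ℝ ∞ f) (hg : ContDiff ℝ ∞ g) (z : Cn k),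
        DifferentiableAt ℝ (fun y => g y * dc f y ![z]) x := fun {f g} hf hg z => by
      have e : (fun y => g y * dc f y ![z])
          = fun y => g y * (-(1 / (2 * Real.pi)) * fderiv ℝ f y (J k z)) := by
        ext y; simp [dc_apply]
      rw [e]
      exact (differentiable_of_smooth hg x).mul (((differentiable_fderiv_of_smooth hf x).clm_apply
        (differentiableAt_const _)).const_mul _)
    have h2 : ∀ z y : Cn k, fderiv ℝ (fun y => β y ![z]) x y
        = (g x * fderiv ℝ (fun y => dc f y ![z]) x y + dc f x ![z] * fderiv ℝ g x y)
        - (f x * fderiv ℝ (fun y => dc g y ![z]) x y + dc g x ![z] * fderiv ℝ f x y) := by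
      intro z y
      rw [← fderiv_mul_dc_apply f.contDiff hg, ← fderiv_mul_dc_apply hg f.contDiff]
      simp only [e]
      rw [fderiv_fun_sub (hd f.contDiff hg z) (hd hg f.contDiff z)]
      rfl
    rw [extDeriv_one_apply (β.contDiff.differentiable (by simp) x), h2, h2, ddc,
      extDeriv_one_apply ((contDiff_dc f.contDiff).differentiable (by simp) x), ddc,
      extDeriv_one_apply ((contDiff_dc hg).differentiable (by simp) x)]
    ring
  have h := hb (smulTest g hg (ddcTest f) - testSmul f (ddc g) (contDiff_ddc hg) - dTest β)
    fun x v w => by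
      simp only [sub_apply, ContinuousAlternatingMap.sub_apply, smulTest_apply, testSmul_apply,
        ddcTest_apply, dTest_apply, ContinuousAlternatingMap.smul_apply, smul_eq_mul, hβ, dc_apply,
        Matrix.cons_val_zero, J_J, map_neg]
      ring
  rw [map_sub, map_sub, hc β] at h
  linarith

end Currents

/-! ### The product of a continuous function and a positive current -/

section Product

variable {k : ℕ} {U : Opens (Cn k)}

lemma smulTest_sub {n : ℕ} {g₁ g₂ : Cn k → ℝ} (h₁ : ContDiff ℝ ∞ g₁) (h₂ : ContDiff ℝ ∞ g₂)
    (η : 𝓓(U, Alt k n)) :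
    smulTest g₁ h₁ η - smulTest g₂ h₂ η = smulTest (fun x => g₁ x - g₂ x) (h₁.sub h₂) η := by
  ext1 x
  exact (sub_smul (g₁ x) (g₂ x) (η x)).symm

/-- Multiplication by locally uniformly close smooth functions gives close pairings. -/
lemma exists_abs_smulTest_sub_le {T : Current U} (hb : HasBidegree T) (hT : IsPositive T)
    (η : 𝓓(U, Alt k 2)) :
    ∃ C : ℝ, 0 < C ∧ ∀ (g₁ g₂ : Cn k → ℝ) (h₁ : ContDiff ℝ ∞ g₁) (h₂ : ContDiff ℝ ∞ g₂) (B : ℝ),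
      0 ≤ B → (∀ x ∈ tsupport η, |g₁ x - g₂ x| ≤ B) →
        |T (smulTest g₁ h₁ η) - T (smulTest g₂ h₂ η)| ≤ C * B := by
  obtain ⟨C, hC, h⟩ := exists_order_zero_bound hb hT η.hasCompactSupport η.tsupport_subset
  obtain ⟨D, hD⟩ := η.hasCompactSupport.exists_bound_of_continuous η.continuous
  have hD0 : 0 ≤ D := (norm_nonneg _).trans (hD 0)
  refine ⟨C * D + 1, by positivity, fun g₁ g₂ h₁ h₂ B hB hg => ?_⟩
  rw [← map_sub, smulTest_sub]
  refine (h _ (B * D) (fun x hx => ?_) fun x => ?_).trans (by nlinarith)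
  · simp [image_eq_zero_of_notMem_tsupport hx]
  · by_cases hx : x ∈ tsupport η
    · rw [smulTest_apply, norm_smul, Real.norm_eq_abs]
      exact mul_le_mul (hg x hx) (hD x) (norm_nonneg _) hB
    · simp only [smulTest_apply, image_eq_zero_of_notMem_tsupport hx, smul_zero, norm_zero]
      positivity

lemma tendsto_sub_of_tendstoLocallyUniformlyOn {T : Current U} (hb : HasBidegree T)
    (hT : IsPositive T) {u : Cn k → ℝ} {un vn : ℕ → Cn k → ℝ} (hun : ∀ n, ContDiff ℝ ∞ (un n))
    (hvn : ∀ n, ContDiff ℝ ∞ (vn n))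
    (hu : TendstoLocallyUniformlyOn un u atTop (U : Set (Cn k)))
    (hv : TendstoLocallyUniformlyOn vn u atTop (U : Set (Cn k))) (η : 𝓓(U, Alt k 2)) {e : ℝ}
    (he : 0 < e) :
    ∃ N, ∀ n ≥ N, ∀ m ≥ N,
      |T (smulTest (un n) (hun n) η) - T (smulTest (vn m) (hvn m) η)| < e := by
  obtain ⟨C, hC, h⟩ := exists_abs_smulTest_sub_le hb hT η
  have hK := η.hasCompactSupport.isCompact
  have h1 := Metric.tendstoUniformlyOn_iff.1 ((tendstoLocallyUniformlyOn_iff_forall_isCompact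
    U.isOpen).1 hu _ η.tsupport_subset hK) (e / (4 * C)) (by positivity)
  have h2 := Metric.tendstoUniformlyOn_iff.1 ((tendstoLocallyUniformlyOn_iff_forall_isCompact
    U.isOpen).1 hv _ η.tsupport_subset hK) (e / (4 * C)) (by positivity)
  obtain ⟨N₁, hN₁⟩ := eventually_atTop.1 h1
  obtain ⟨N₂, hN₂⟩ := eventually_atTop.1 h2
  refine ⟨max N₁ N₂, fun n hn m hm => ?_⟩
  refine (h _ _ (hun n) (hvn m) (e / (2 * C)) (by positivity) fun x hx => ?_).trans_lt ?_
  · have a := hN₁ n (le_of_max_le_left hn) x hx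
    have b := hN₂ m (le_of_max_le_right hm) x hx
    rw [dist_comm] at a
    have c := dist_triangle (un n x) (u x) (vn m x)
    rw [Real.dist_eq (un n x) (vn m x)] at c
    have : e / (2 * C) = e / (4 * C) + e / (4 * C) := by field_simp; norm_num
    linarith
  · rw [mul_div_assoc', div_lt_iff₀ (by positivity)]
    nlinarith

/-- The product of a function with a positive current exists, provided that the function is
locally uniformly on `U` a limit of smooth functions: the pairings converge, and by the order zero
bound the limit is continuous and does not depend on the approximation. -/
lemma exists_isProduct {T : Current U} (hb : HasBidegree T) (hT : IsPositive T) {u : Cn k → ℝ}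
    {un : ℕ → Cn k → ℝ} (hun : ∀ n, ContDiff ℝ ∞ (un n))
    (hu : TendstoLocallyUniformlyOn un u atTop (U : Set (Cn k))) :
    ∃ S : Current U, IsProduct u T S := by
  have hcauchy : ∀ η : 𝓓(U, Alt k 2), ∃ l : ℝ,
      Tendsto (fun n => T (smulTest (un n) (hun n) η)) atTop (𝓝 l) := fun η =>
    cauchySeq_tendsto_of_complete (Metric.cauchySeq_iff.2 fun e he =>
      tendsto_sub_of_tendstoLocallyUniformlyOn hb hT hun hun hu hu η he)
  choose s hs using hcauchy
  have hadd : ∀ η θ, s (η + θ) = s η + s θ := fun η θ => by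
    refine tendsto_nhds_unique (hs _) (((hs η).add (hs θ)).congr fun n => ?_)
    rw [← map_add]
    congr 1
    ext1 x
    simp
  have hsmul : ∀ (c : ℝ) η, s (c • η) = c • s η := fun c η => by
    refine tendsto_nhds_unique (hs _) (((hs η).const_smul c).congr fun n => ?_)
    rw [← map_smul]
    congr 1
    ext1 x
    simp [smul_comm c]
  have hbound : ∀ (K : Compacts (Cn k)), (K : Set (Cn k)) ⊆ U → ∃ C : ℝ, 0 ≤ C ∧
      ∀ (η : 𝓓(U, Alt k 2)) (B : ℝ), (∀ x, x ∉ K → η x = 0) → (∀ x, ‖η x‖ ≤ B) →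
        |s η| ≤ C * B := by
    intro K hKU
    obtain ⟨C, hC, h⟩ := exists_order_zero_bound hb hT K.isCompact hKU
    have h1 := Metric.tendstoUniformlyOn_iff.1 ((tendstoLocallyUniformlyOn_iff_forall_isCompact
      U.isOpen).1 hu _ hKU K.isCompact) 1 one_pos
    obtain ⟨N, hN⟩ := eventually_atTop.1 h1
    obtain ⟨D, hD⟩ := K.isCompact.exists_bound_of_continuousOn (hun N).continuous.continuousOn
    have hD' : ∀ n ≥ N, ∀ x ∈ K, |un n x| ≤ |D| + 2 := fun n hn x hx => by
      have a := hN n hn x hx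
      have b := hN N le_rfl x hx
      have c := hD x hx
      rw [Real.dist_eq] at a b
      rw [Real.norm_eq_abs] at c
      have := le_abs_self D
      rw [abs_lt] at a b
      rw [abs_le] at c ⊢
      constructor <;> linarith
    refine ⟨C * (|D| + 2), by positivity, fun η B hη hB => ?_⟩
    have hB0 : 0 ≤ B := (norm_nonneg _).trans (hB 0)
    refine le_of_tendsto (hs η).abs (eventually_atTop.2 ⟨N, fun n hn => ?_⟩)
    rw [mul_assoc]
    refine h _ _ (fun x hx => by simp [hη x hx]) fun x => ?_
    by_cases hx : x ∈ K
    · rw [smulTest_apply, norm_smul, Real.norm_eq_abs]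
      exact mul_le_mul (hD' n hn x hx) (hB x) (norm_nonneg _) (by positivity)
    · simp only [smulTest_apply, hη x hx, smul_zero, norm_zero]
      positivity
  -- continuity is tested on the forms supported in a fixed compact set
  refine ⟨TestFunction.limitCLM ℝ s (fun K hKU =>
    ContDiffMapSupportedIn.mkCLMtoNormedSpace ℝ (fun f => s (TestFunction.ofSupportedIn hKU f))
      (fun f g => hadd (TestFunction.ofSupportedIn hKU f) (TestFunction.ofSupportedIn hKU g))
      (fun c f => hsmul c (TestFunction.ofSupportedIn hKU f)) ?_) (fun K hKU f => rfl), ?_⟩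
  · obtain ⟨C, hC, h⟩ := hbound K hKU
    refine ⟨{0}, C, hC, fun f => ?_⟩
    rw [Finset.sup_singleton]
    exact h _ _ (fun x hx => f.zero_on_compl hx) fun x =>
      ContDiffMapSupportedIn.norm_apply_le_seminorm ℝ
  · intro vn hvn hv η
    have h0 : Tendsto (fun n => T (smulTest (un n) (hun n) η)
        - T (smulTest (vn n) (hvn n) η)) atTop (𝓝 0) := by
      rw [Metric.tendsto_atTop]
      intro e he
      obtain ⟨N, hN⟩ := tendsto_sub_of_tendstoLocallyUniformlyOn hb hT hun hvn hu hv η he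
      exact ⟨N, fun n hn => by simpa using hN n hn n hn⟩
    have h1 := (hs η).sub h0
    simp only [sub_sub_cancel, sub_zero] at h1
    exact h1

end Product

/-! ### Positive distributions are measures -/

section RieszRepresentation

open scoped CompactlySupported

variable {k : ℕ} {U : Opens (Cn k)}

/-- The restriction to `U` of test functions on `U`, as a linear map into the compactly supported
continuous functions. -/
noncomputable def testToCc (U : Opens (Cn k)) : 𝓓(U, ℝ) →ₗ[ℝ] C_c(U, ℝ) where
  toFun f :=
    { toFun := fun x => f x
      continuous_toFun := f.continuous.comp continuous_subtype_val
      hasCompactSupport' := HasCompactSupport.intro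
        (IsInducing.subtypeVal.isCompact_preimage' f.hasCompactSupport.isCompact (by
          simpa using f.tsupport_subset))
        fun x hx => image_eq_zero_of_notMem_tsupport hx }
  map_add' f g := rfl
  map_smul' c f := rfl

lemma testToCc_injective : Function.Injective (testToCc U) := fun f g h => by
  ext1 x
  by_cases hx : x ∈ U
  · exact DFunLike.congr_fun h (⟨x, hx⟩ : U)
  · rw [image_eq_zero_of_notMem_tsupport fun h => hx (f.tsupport_subset h),
      image_eq_zero_of_notMem_tsupport fun h => hx (g.tsupport_subset h)]

/-- A positive distribution is a Radon measure. It extends to a positive functional on the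
continuous functions with compact support by the extension theorem of M. Riesz. -/
lemma exists_isMeasureOf (L : 𝓓(U, ℝ) →ₗ[ℝ] ℝ) (hL : ∀ f, (∀ x, 0 ≤ f x) → 0 ≤ L f) :
    ∃ μ : Measure (Cn k), IsMeasureOf L μ := by
  let s : PointedCone ℝ C_c(U, ℝ) :=
    { carrier := {f | ∀ x, 0 ≤ f x}
      zero_mem' := fun x => le_rfl
      add_mem' := fun {f g} hf hg x => add_nonneg (hf x) (hg x)
      smul_mem' := fun c f hf x => mul_nonneg c.2 (hf x) }
  let e := LinearEquiv.ofInjective (testToCc U) testToCc_injective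
  let F : C_c(U, ℝ) →ₗ.[ℝ] ℝ := ⟨LinearMap.range (testToCc U), L ∘ₗ e.symm.toLinearMap⟩
  have hF : ∀ f, F (e f) = L f := fun f => by
    change L (e.symm (e f)) = L f
    rw [e.symm_apply_apply]
  obtain ⟨g, hg, hgs⟩ := riesz_extension s F
    (by
      intro y hy
      obtain ⟨f, rfl⟩ := e.surjective y
      rw [hF]
      refine hL f fun x => ?_
      by_cases hx : x ∈ U
      · exact hy ⟨x, hx⟩
      · rw [image_eq_zero_of_notMem_tsupport fun h => hx (f.tsupport_subset h)])
    -- every `y` is bounded below by a test function, a multiple of a cutoff function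
    (by
      intro y
      have hK : IsCompact ((↑) '' tsupport y : Set (Cn k)) :=
        y.hasCompactSupport.isCompact.image continuous_subtype_val
      obtain ⟨χ, hχ, hχ1⟩ := exists_cutoff hK (U := U) (by rintro _ ⟨x, -, rfl⟩; exact x.2)
      obtain ⟨B, hB⟩ := y.hasCompactSupport.exists_bound_of_continuous y.continuous
      refine ⟨e (B • χ), fun x => ?_⟩
      change 0 ≤ B * χ x + y x
      by_cases hx : x ∈ tsupport y
      · rw [hχ1 x ⟨x, hx, rfl⟩]
        have := (abs_le.1 (hB x)).1
        linarith
      · rw [image_eq_zero_of_notMem_tsupport hx]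
        have := (norm_nonneg _).trans (hB x)
        have := (hχ x).1
        positivity)
  let Λ : C_c(U, ℝ) →ₚ[ℝ] ℝ := PositiveLinearMap.mk₀ g fun f hf => hgs f fun x => hf x
  have : LocallyCompactSpace U := U.isOpen.locallyCompactSpace
  have hm : MeasurableEmbedding ((↑) : U → Cn k) :=
    MeasurableEmbedding.subtype_coe U.isOpen.measurableSet
  refine ⟨(RealRMK.rieszMeasure Λ).map (↑), fun K hK hKU => ?_, fun f => ?_⟩
  · rw [hm.map_apply]
    exact (IsInducing.subtypeVal.isCompact_preimage' hK (by simpa using hKU)).measure_lt_top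
  · rw [hm.integral_map]
    have h := RealRMK.integral_rieszMeasure Λ (testToCc U f)
    rw [← hF f, ← hg]
    exact h

end RieszRepresentation

/-! ### Mollification by radial kernels -/

section Taylor

variable {k : ℕ} {f : Cn k → ℝ}

/-- The second order Taylor expansion, with a remainder which is uniform in all directions. -/
lemma exists_taylor_two (hf : ContDiff ℝ ∞ f) (x : Cn k) {e : ℝ} (he : 0 < e) :
    ∃ d > 0, ∀ w : Cn k, ‖w‖ < d →
      |f (x + w) - f x - fderiv ℝ f x w - 1 / 2 * fderiv ℝ (fderiv ℝ f) x w w| ≤ e * ‖w‖ ^ 2 := by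
  set A := fderiv ℝ (fderiv ℝ f) x
  have hA : HasFDerivAt (fderiv ℝ f) A x := (differentiable_fderiv_of_smooth hf x).hasFDerivAt
  obtain ⟨d, hd, h⟩ := Metric.eventually_nhds_iff.1
    ((hasFDerivAt_iff_isLittleO_nhds_zero.1 hA).def he)
  refine ⟨d, hd, fun w hw => ?_⟩
  set G : Cn k → ℝ := fun z => f (x + z) - fderiv ℝ f x z - 1 / 2 * A z z
  have hG : ∀ z, HasFDerivAt G (fderiv ℝ f (x + z) - fderiv ℝ f x - A z) z := by
    intro z
    have h1 : HasFDerivAt (fun z => f (x + z)) (fderiv ℝ f (x + z)) z := by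
      exact ((differentiable_of_smooth hf (x + z)).hasFDerivAt.comp z
        ((hasFDerivAt_id z).const_add x)).congr_fderiv (ContinuousLinearMap.comp_id _)
    have h2 := (A.hasFDerivAt (x := z)).clm_apply (hasFDerivAt_id z)
    refine ((h1.sub (fderiv ℝ f x).hasFDerivAt).sub (h2.const_mul (1 / 2))).congr_fderiv ?_
    ext v
    have h3 := fderiv_fderiv_symm hf x v z
    simp only [sub_apply, smul_apply, add_apply, ContinuousLinearMap.comp_apply, _root_.id,
      ContinuousLinearMap.flip_apply, smul_eq_mul, ContinuousLinearMap.coe_id']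
    change _ - 1 / 2 * (A z v + A v z) = _
    change A v z = A z v at h3
    rw [h3]
    ring
  have hb : ∀ z ∈ Metric.closedBall (0 : Cn k) ‖w‖,
      ‖fderiv ℝ f (x + z) - fderiv ℝ f x - A z‖ ≤ e * ‖w‖ := by
    intro z hz
    rw [mem_closedBall_zero_iff] at hz
    refine (h (y := z) (by simpa using hz.trans_lt hw)).trans ?_
    gcongr
  have h4 := (convex_closedBall (0 : Cn k) ‖w‖).norm_image_sub_le_of_norm_hasFDerivWithin_le
    (fun z _ => (hG z).hasFDerivWithinAt) hb (x := 0) (y := w) (by simp) (by simp)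
  have h5 : G w - G 0 = f (x + w) - f x - fderiv ℝ f x w - 1 / 2 * A w w := by
    simp only [G, add_zero, map_zero]
    ring
  rw [h5, sub_zero, Real.norm_eq_abs] at h4
  linarith [h4]

/-- An upper bound for the symmetric second differences bounds the second derivative. -/
lemma fderiv_fderiv_le_of_second_difference (hf : ContDiff ℝ ∞ f) (x v : Cn k) {C : ℝ}
    (h : ∀ t : ℝ, f (x + t • v) + f (x - t • v) - 2 * f x ≤ C * t ^ 2) :
    fderiv ℝ (fderiv ℝ f) x v v ≤ C := by
  refine le_of_forall_pos_le_add fun e he => ?_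
  obtain ⟨d, hd, hT⟩ := exists_taylor_two hf x (e := e / (2 * (‖v‖ ^ 2 + 1))) (by positivity)
  set t := d / (2 * (‖v‖ + 1)) with ht
  have ht0 : 0 < t := by positivity
  have hs : ‖t • v‖ < d := by
    rw [norm_smul, Real.norm_eq_abs, abs_of_pos ht0, ht, div_mul_eq_mul_div,
      div_lt_iff₀ (by positivity)]
    nlinarith [norm_nonneg v]
  have h1 := (abs_le.1 (hT (t • v) hs)).1
  have h2 := (abs_le.1 (hT (-(t • v)) (by rwa [norm_neg]))).1
  rw [← sub_eq_add_neg, norm_neg] at h2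
  simp only [map_neg, neg_apply, map_smul, smul_apply, smul_eq_mul, norm_smul,
    Real.norm_eq_abs, abs_of_pos ht0, mul_pow] at h1 h2
  have h3 := h t
  have h4 : t ^ 2 * fderiv ℝ (fderiv ℝ f) x v v ≤ t ^ 2 * (C + e) := by
    have h5 : e / (2 * (‖v‖ ^ 2 + 1)) * (t ^ 2 * ‖v‖ ^ 2) ≤ e / 2 * t ^ 2 := by
      rw [div_mul_eq_mul_div, div_le_iff₀ (by positivity)]
      nlinarith [mul_nonneg he.le (sq_nonneg t)]
    linarith
  exact le_of_mul_le_mul_left h4 (by positivity)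

end Taylor

section Convolution

variable {k : ℕ}

/-- The convolution of a function with a kernel. -/
noncomputable def conv (g κ : Cn k → ℝ) (x : Cn k) : ℝ := ∫ t, g t * κ (x - t)

lemma conv_eq (g κ : Cn k → ℝ) :
    conv g κ = convolution g κ (ContinuousLinearMap.mul ℝ ℝ) volume := rfl

lemma conv_eq_integral_sub (g κ : Cn k → ℝ) (x : Cn k) :
    conv g κ x = ∫ y, g (x - y) * κ y := by
  rw [conv, ← integral_sub_left_eq_self _ _ x]
  simp

variable {g κ : Cn k → ℝ}

lemma integrable_conv (hg : LocallyIntegrable g) (hκ : Continuous κ) (hc : HasCompactSupport κ)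
    (x : Cn k) : Integrable fun t => g t * κ (x - t) :=
  hc.convolutionExists_right (ContinuousLinearMap.mul ℝ ℝ) hg hκ x

lemma integrable_conv_sub (hg : LocallyIntegrable g) (hκ : Continuous κ)
    (hc : HasCompactSupport κ) (x : Cn k) : Integrable fun y => g (x - y) * κ y := by
  have := (integrable_conv hg hκ hc x).comp_sub_left x
  simpa using this

lemma contDiff_conv (hg : LocallyIntegrable g) (hκ : ContDiff ℝ ∞ κ) (hc : HasCompactSupport κ) :
    ContDiff ℝ ∞ (conv g κ) :=
  hc.contDiff_convolution_right (ContinuousLinearMap.mul ℝ ℝ) hg hκ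

lemma fderiv_conv (hg : LocallyIntegrable g) (hκ : ContDiff ℝ ∞ κ) (hc : HasCompactSupport κ)
    (x v : Cn k) : fderiv ℝ (conv g κ) x v = conv g (fun a => fderiv ℝ κ a v) x := by
  rw [conv_eq, (hc.hasFDerivAt_convolution_right (ContinuousLinearMap.mul ℝ ℝ) hg
    (hκ.of_le (by simp)) x).fderiv, convolution_precompR_apply _ hg (hc.fderiv ℝ)
    (contDiff_fderiv_of_smooth hκ).continuous]
  rfl

lemma hasCompactSupport_fderiv_apply (hc : HasCompactSupport κ) (v : Cn k) :
    HasCompactSupport fun a => fderiv ℝ κ a v :=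
  (hc.fderiv ℝ).comp_left (g := fun A : Cn k →L[ℝ] ℝ => A v) (by simp)

lemma contDiff_fderiv_apply (hκ : ContDiff ℝ ∞ κ) (v : Cn k) :
    ContDiff ℝ ∞ fun a => fderiv ℝ κ a v :=
  (contDiff_fderiv_of_smooth hκ).clm_apply contDiff_const

lemma fderiv_fderiv_apply (hκ : ContDiff ℝ ∞ κ) (x v w : Cn k) :
    fderiv ℝ (fun a => fderiv ℝ κ a w) x v = fderiv ℝ (fderiv ℝ κ) x v w := by
  have h := ((differentiable_fderiv_of_smooth hκ x).hasFDerivAt.clm_apply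
    (hasFDerivAt_const w x)).fderiv
  rw [h]
  simp

lemma fderiv_fderiv_conv (hg : LocallyIntegrable g) (hκ : ContDiff ℝ ∞ κ)
    (hc : HasCompactSupport κ) (x v w : Cn k) :
    fderiv ℝ (fderiv ℝ (conv g κ)) x v w
      = conv g (fun a => fderiv ℝ (fderiv ℝ κ) a v w) x := by
  rw [← fderiv_fderiv_apply (contDiff_conv hg hκ hc)]
  have e : (fun a => fderiv ℝ (conv g κ) a w) = conv g (fun a => fderiv ℝ κ a w) := by
    ext1 a; exact fderiv_conv hg hκ hc a w
  rw [e, fderiv_conv hg (contDiff_fderiv_apply hκ w) (hasCompactSupport_fderiv_apply hc w)]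
  congr 1
  ext1 a
  exact fderiv_fderiv_apply hκ a v w

lemma levi_conv (hg : LocallyIntegrable g) (hκ : ContDiff ℝ ∞ κ) (hc : HasCompactSupport κ)
    (x v : Cn k) : levi (conv g κ) x v = ∫ t, g t * levi κ (x - t) v := by
  have h1 : ∀ w : Cn k, Integrable fun t => g t * fderiv ℝ (fderiv ℝ κ) (x - t) w w := by
    intro w
    have := integrable_conv hg
      (contDiff_fderiv_apply (contDiff_fderiv_apply hκ w) w).continuous
      (hasCompactSupport_fderiv_apply (hasCompactSupport_fderiv_apply hc w) w) x
    simpa only [fderiv_fderiv_apply hκ] using this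
  rw [levi, fderiv_fderiv_conv hg hκ hc, fderiv_fderiv_conv hg hκ hc, conv, conv,
    ← integral_add (h1 v) (h1 (J k v))]
  simp only [levi, mul_add]

lemma levi_comp_sub (hκ : ContDiff ℝ ∞ κ) (x y v : Cn k) :
    levi (fun y => κ (x - y)) y v = levi κ (x - y) v := by
  have e : fderiv ℝ (fun y => κ (x - y)) = fun y => -fderiv ℝ κ (x - y) := by
    ext1 y
    have h : HasFDerivAt (fun y => κ (x - y)) _ y :=
      (differentiable_of_smooth hκ (x - y)).hasFDerivAt.comp y ((hasFDerivAt_id y).const_sub x)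
    rw [h.fderiv]
    ext v; simp
  have h := ((differentiable_fderiv_of_smooth hκ (x - y)).hasFDerivAt.comp y
    ((hasFDerivAt_id y).const_sub x)).neg
  have h2 : fderiv ℝ (fun y => -fderiv ℝ κ (x - y)) y = _ := h.fderiv
  rw [levi, e, h2, levi]
  simp

end Convolution

section Kernel

variable {k : ℕ}

/-- The radial profile `smoothTransition (1 - ‖x‖² / r²)`, supported in the ball of radius `r`.
Mathlib's `ContDiffBump` need not be invariant under rotations. -/
noncomputable def bump (k : ℕ) (r : ℝ) (x : Cn k) : ℝ := Real.smoothTransition (1 - ‖x‖ ^ 2 / r ^ 2)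

/-- The radial mollifier of radius `r`. -/
noncomputable def kern (k : ℕ) (r : ℝ) (x : Cn k) : ℝ := bump k r x / ∫ y, bump k r y

lemma contDiff_bump (k : ℕ) (r : ℝ) : ContDiff ℝ ∞ (bump k r) :=
  Real.smoothTransition.contDiff.comp (contDiff_const.sub (contDiff_normSq.div_const _))

lemma bump_eq_zero {r : ℝ} (hr : 0 < r) {x : Cn k} (hx : r ≤ ‖x‖) : bump k r x = 0 := by
  apply Real.smoothTransition.zero_of_nonpos
  rw [sub_nonpos, one_le_div (by positivity)]
  gcongr

lemma hasCompactSupport_bump {r : ℝ} (hr : 0 < r) : HasCompactSupport (bump k r) :=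
  HasCompactSupport.intro (isCompact_closedBall 0 r) fun x hx => bump_eq_zero hr (by
    rw [mem_closedBall_zero_iff, not_le] at hx
    exact hx.le)

lemma integral_bump_pos {r : ℝ} (hr : 0 < r) : 0 < ∫ y, bump k r y := by
  refine (contDiff_bump k r).continuous.integral_pos_of_hasCompactSupport_nonneg_nonzero
    (hasCompactSupport_bump hr) (fun x => Real.smoothTransition.nonneg _) (x := 0) ?_
  simp [bump]

lemma contDiff_kern (k : ℕ) (r : ℝ) : ContDiff ℝ ∞ (kern k r) := (contDiff_bump k r).div_const _

lemma kern_nonneg {r : ℝ} (hr : 0 < r) (x : Cn k) : 0 ≤ kern k r x :=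
  div_nonneg (Real.smoothTransition.nonneg _) (integral_bump_pos hr).le

lemma kern_eq_zero {r : ℝ} (hr : 0 < r) {x : Cn k} (hx : r ≤ ‖x‖) : kern k r x = 0 := by
  rw [kern, bump_eq_zero hr hx, zero_div]

lemma hasCompactSupport_kern {r : ℝ} (hr : 0 < r) : HasCompactSupport (kern k r) :=
  HasCompactSupport.intro (isCompact_closedBall 0 r) fun x hx => kern_eq_zero hr (by
    rw [mem_closedBall_zero_iff, not_le] at hx
    exact hx.le)

lemma integral_kern {r : ℝ} (hr : 0 < r) : ∫ y, kern k r y = 1 := by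
  simp only [kern]
  rw [integral_div, div_self (integral_bump_pos hr).ne']

lemma kern_congr (r : ℝ) {x y : Cn k} (h : ‖x‖ = ‖y‖) : kern k r x = kern k r y := by
  simp [kern, bump, h]

lemma integrable_kern {r : ℝ} (hr : 0 < r) : Integrable (kern k r) :=
  (contDiff_kern k r).continuous.integrable_of_hasCompactSupport (hasCompactSupport_kern hr)

/-- The mollification of a function at scale `r`. -/
noncomputable def mollify (r : ℝ) (g : Cn k → ℝ) : Cn k → ℝ := conv g (kern k r)

variable {g : Cn k → ℝ} {r : ℝ}

lemma contDiff_mollify (hr : 0 < r) (hg : LocallyIntegrable g) : ContDiff ℝ ∞ (mollify r g) :=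
  contDiff_conv hg (contDiff_kern k r) (hasCompactSupport_kern hr)

lemma integrable_mollify (hr : 0 < r) (hg : LocallyIntegrable g) (x : Cn k) :
    Integrable fun y => g (x - y) * kern k r y :=
  integrable_conv_sub hg (contDiff_kern k r).continuous (hasCompactSupport_kern hr) x

/-- A bound for `g` almost everywhere on a ball bounds its mollification at the centre. -/
lemma mollify_le (hr : 0 < r) (hg : LocallyIntegrable g) {x : Cn k} {s : ℝ}
    (h : ∀ᵐ t, ‖x - t‖ < r → g t ≤ s) : mollify r g x ≤ s := by
  have h1 : ∫ t, s * kern k r (x - t) = s := by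
    rw [integral_sub_left_eq_self (fun y => s * kern k r y) _ x, integral_const_mul,
      integral_kern hr, mul_one]
  rw [mollify, conv, ← h1]
  refine integral_mono_ae (integrable_conv hg (contDiff_kern k r).continuous
    (hasCompactSupport_kern hr) x) (((integrable_kern hr).comp_sub_left x).const_mul s) ?_
  filter_upwards [h] with t ht
  rcases lt_or_ge ‖x - t‖ r with h2 | h2
  · exact mul_le_mul_of_nonneg_right (ht h2) (kern_nonneg hr _)
  · simp [kern_eq_zero hr h2]

lemma abs_mollify_sub_le (hr : 0 < r) (hg : LocallyIntegrable g) {x : Cn k} {s a : ℝ}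
    (h : ∀ t, ‖x - t‖ < r → |g t - a| ≤ s) : |mollify r g x - a| ≤ s := by
  have h1 : mollify r g x ≤ a + s := mollify_le hr hg (ae_of_all _ fun t ht => by
    linarith [(abs_le.1 (h t ht)).2])
  have h2 : mollify r (fun t => -g t) x ≤ -a + s := mollify_le hr hg.neg (ae_of_all _ fun t ht => by
    change -g t ≤ -a + s
    linarith [(abs_le.1 (h t ht)).1])
  have h3 : mollify r (fun t => -g t) x = -mollify r g x := by
    simp only [mollify, conv, neg_mul]
    exact integral_neg _
  rw [abs_le]
  constructor <;> linarith

lemma mollify_second_difference_le (hr : 0 < r) (hg : LocallyIntegrable g) {w : Cn k} {C : ℝ}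
    (h : ∀ x, g (x + w) + g (x - w) - 2 * g x ≤ C) (x : Cn k) :
    mollify r g (x + w) + mollify r g (x - w) - 2 * mollify r g x ≤ C := by
  have h1 : ∫ y, C * kern k r y = C := by
    rw [integral_const_mul, integral_kern hr, mul_one]
  have i1 := integrable_mollify hr hg (x + w)
  have i2 := integrable_mollify hr hg (x - w)
  have i3 := (integrable_mollify hr hg x).const_mul 2
  have i4 : Integrable fun y => g (x + w - y) * kern k r y + g (x - w - y) * kern k r y := i1.add i2
  rw [mollify, conv_eq_integral_sub, conv_eq_integral_sub, conv_eq_integral_sub,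
    ← integral_const_mul, ← integral_add i1 i2, ← integral_sub i4 i3]
  refine (integral_mono (i4.sub i3) ((integrable_kern hr).const_mul C) fun y => ?_).trans_eq
    h1
  have h2 := h (x - y)
  have h3 := kern_nonneg hr y
  have e1 : x + w - y = x - y + w := by abel
  have e2 : x - w - y = x - y - w := by abel
  change g (x + w - y) * kern k r y + g (x - w - y) * kern k r y - 2 * (g (x - y) * kern k r y)
    ≤ C * kern k r y
  rw [e1, e2]
  nlinarith

end Kernel

/-! ### Regularization of plurisubharmonic functions -/

section Psh

variable {k : ℕ}

lemma circleMap_smul (θ : ℝ) (b : Cn k) :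
    circleMap 0 1 θ • b = Real.cos θ • b + Real.sin θ • J k b := by
  rw [circleMap, J_apply]
  simp only [Complex.ofReal_one, one_mul, zero_add, Complex.exp_mul_I, add_smul, mul_smul,
    ← Complex.ofReal_cos, ← Complex.ofReal_sin, Complex.coe_smul]

lemma norm_circleMap_smul (θ : ℝ) (b : Cn k) : ‖circleMap 0 1 θ • b‖ = ‖b‖ := by
  simp [norm_smul]

/-- A smooth function with the sub-mean value property has a nonnegative Levi form: the circle
average of the second order Taylor polynomial exceeds the value at the centre by a quarter of the
Levi form. -/
lemma levi_nonneg_of_submean {f : Cn k → ℝ} (hf : ContDiff ℝ ∞ f) (a : Cn k)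
    (h : ∀ b : Cn k, f a ≤ (2 * Real.pi)⁻¹ * ∫ θ in (0 : ℝ)..2 * Real.pi,
      f (a + circleMap 0 1 θ • b)) (v : Cn k) : 0 ≤ levi f a v := by
  refine le_of_forall_pos_le_add fun e he => ?_
  obtain ⟨d, hd, hT⟩ := exists_taylor_two hf a (e := e / (4 * (‖v‖ ^ 2 + 1))) (by positivity)
  set t := d / (2 * (‖v‖ + 1)) with ht
  have ht0 : 0 < t := by positivity
  have hs : ‖t • v‖ < d := by
    rw [norm_smul, Real.norm_eq_abs, abs_of_pos ht0, ht, div_mul_eq_mul_div,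
      div_lt_iff₀ (by positivity)]
    nlinarith [norm_nonneg v]
  set b := t • v
  set D := fderiv ℝ f a
  set A := fderiv ℝ (fderiv ℝ f) a
  set e' := e / (4 * (‖v‖ ^ 2 + 1))
  have hle : ∀ θ : ℝ, f (a + circleMap 0 1 θ • b) ≤ f a + e' * ‖b‖ ^ 2
      + (Real.cos θ * D b + Real.sin θ * D (J k b))
      + 1 / 2 * (Real.cos θ ^ 2 * A b b + 2 * (Real.sin θ * Real.cos θ) * A b (J k b)
        + Real.sin θ ^ 2 * A (J k b) (J k b)) := by
    intro θ
    have h1 := (abs_le.1 (hT (circleMap 0 1 θ • b) (by rwa [norm_circleMap_smul]))).2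
    rw [norm_circleMap_smul] at h1
    have h2 : A (J k b) b = A b (J k b) := fderiv_fderiv_symm hf a _ _
    have h3 : A (circleMap 0 1 θ • b) (circleMap 0 1 θ • b)
        = Real.cos θ ^ 2 * A b b + 2 * (Real.sin θ * Real.cos θ) * A b (J k b)
          + Real.sin θ ^ 2 * A (J k b) (J k b) := by
      simp only [circleMap_smul, map_add, map_smul, add_apply, smul_apply, smul_eq_mul, h2]
      ring
    have h4 : D (circleMap 0 1 θ • b) = Real.cos θ * D b + Real.sin θ * D (J k b) := by
      simp only [circleMap_smul, map_add, map_smul, smul_eq_mul]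
    rw [h3, h4] at h1
    linarith
  have hint : ∫ θ in (0 : ℝ)..2 * Real.pi, (f a + e' * ‖b‖ ^ 2
      + (Real.cos θ * D b + Real.sin θ * D (J k b))
      + 1 / 2 * (Real.cos θ ^ 2 * A b b + 2 * (Real.sin θ * Real.cos θ) * A b (J k b)
        + Real.sin θ ^ 2 * A (J k b) (J k b)))
      = 2 * Real.pi * (f a + e' * ‖b‖ ^ 2 + 1 / 4 * levi f a b) := by
    rw [intervalIntegral.integral_eq_sub_of_hasDerivAt
      (f := fun θ => (f a + e' * ‖b‖ ^ 2) * θ + (Real.sin θ * D b - Real.cos θ * D (J k b))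
        + 1 / 2 * ((θ + Real.sin θ * Real.cos θ) * (1 / 2 * A b b)
          + Real.sin θ ^ 2 * A b (J k b)
          + (θ - Real.sin θ * Real.cos θ) * (1 / 2 * A (J k b) (J k b))))]
    · simp only [Real.sin_two_pi, Real.cos_two_pi, Real.sin_zero, Real.cos_zero, levi]
      ring
    · intro θ _
      have hS := Real.hasDerivAt_sin θ
      have hC := Real.hasDerivAt_cos θ
      have hi := hasDerivAt_id θ
      refine ((((hi.const_mul (f a + e' * ‖b‖ ^ 2)).add
        ((hS.mul_const (D b)).sub (hC.mul_const (D (J k b))))).add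
        (((((hi.add (hS.mul hC)).mul_const (1 / 2 * A b b)).add
          ((hS.pow 2).mul_const (A b (J k b)))).add
          ((hi.sub (hS.mul hC)).mul_const (1 / 2 * A (J k b) (J k b)))).const_mul
          (1 / 2)))).congr_deriv ?_
      have hcs := Real.cos_sq_add_sin_sq θ
      have hc : Real.cos θ ^ 2 = 1 - Real.sin θ ^ 2 := by linarith
      push_cast
      linear_combination (1 / 4 * A b b + 1 / 4 * A (J k b) (J k b)) * (-hcs)
    · exact Continuous.intervalIntegrable (by fun_prop) _ _
  have hmono : ∫ θ in (0 : ℝ)..2 * Real.pi, f (a + circleMap 0 1 θ • b)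
      ≤ 2 * Real.pi * (f a + e' * ‖b‖ ^ 2 + 1 / 4 * levi f a b) := by
    rw [← hint]
    refine intervalIntegral.integral_mono_on (by positivity)
      (Continuous.intervalIntegrable ?_ _ _) (Continuous.intervalIntegrable (by fun_prop) _ _)
      fun θ _ => hle θ
    exact hf.continuous.comp (continuous_const.add
      ((continuous_circleMap 0 1).smul continuous_const))
  have h5 : f a ≤ f a + e' * ‖b‖ ^ 2 + 1 / 4 * levi f a b := by
    refine (h b).trans ?_
    rw [inv_mul_le_iff₀ (by positivity)]
    exact hmono
  have h6 : levi f a b = t ^ 2 * levi f a v := by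
    simp only [levi, b, map_smul, smul_apply, smul_eq_mul]
    ring
  have h7 : ‖b‖ ^ 2 = t ^ 2 * ‖v‖ ^ 2 := by
    rw [norm_smul, mul_pow, Real.norm_eq_abs, sq_abs]
  have h8 : e' * ‖v‖ ^ 2 ≤ e / 4 := by
    simp only [e']
    rw [div_mul_eq_mul_div, div_le_iff₀ (by positivity)]
    nlinarith
  rw [h6, h7] at h5
  have h9 : 0 ≤ t ^ 2 * (levi f a v + e) := by
    nlinarith [mul_le_mul_of_nonneg_left h8 (sq_nonneg t)]
  exact nonneg_of_mul_nonneg_right h9 (by positivity)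

/-- Integration of sub-mean value inequalities over circles against a mollifier, for circles
`θ ↦ p θ y` depending on the integration variable `y`. -/
lemma integral_mul_kern_le {G : Cn k → ℝ} (hG : Measurable G) {r : ℝ} (hr : 0 < r)
    {p : ℝ → Cn k → Cn k} (hp : Continuous (Function.uncurry p))
    (hI : ∀ θ, Integrable fun y => G (p θ y) * kern k r y)
    (hC : Continuous fun θ => ∫ y, |G (p θ y)| * kern k r y)
    {c : Cn k → ℝ} (hci : Integrable fun y => c y * kern k r y)
    (hc : ∀ᵐ y, c y ≤ (2 * Real.pi)⁻¹ * ∫ θ in (0 : ℝ)..2 * Real.pi, G (p θ y)) :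
    ∫ y, c y * kern k r y
      ≤ (2 * Real.pi)⁻¹ * ∫ θ in (0 : ℝ)..2 * Real.pi, ∫ y, G (p θ y) * kern k r y := by
  have hpi : (0 : ℝ) ≤ 2 * Real.pi := by positivity
  simp only [intervalIntegral.integral_of_le hpi] at hc ⊢
  set ν : Measure ℝ := volume.restrict (Ioc 0 (2 * Real.pi))
  set H : ℝ → Cn k → ℝ := fun θ y => G (p θ y) * kern k r y
  have hm : Measurable (Function.uncurry H) := by
    have h1 : Measurable fun z : ℝ × Cn k => G (Function.uncurry p z) := hG.comp hp.measurable
    exact h1.mul ((contDiff_kern k r).continuous.measurable.comp measurable_snd)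
  have hH : Integrable (Function.uncurry H) (ν.prod volume) := by
    rw [integrable_prod_iff hm.aestronglyMeasurable]
    refine ⟨ae_of_all _ hI, ?_⟩
    have e : (fun θ => ∫ y, ‖Function.uncurry H (θ, y)‖)
        = fun θ => ∫ y, |G (p θ y)| * kern k r y := by
      ext θ
      congr 1
      ext y
      simp only [Function.uncurry_apply_pair, H, norm_mul, Real.norm_eq_abs]
      rw [abs_of_nonneg (kern_nonneg hr y)]
    rw [e]
    exact (hC.integrableOn_Icc (a := 0) (b := 2 * Real.pi)).mono_set Ioc_subset_Icc_self
  rw [integral_integral_swap hH, ← integral_const_mul]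
  refine integral_mono_ae hci (hH.integral_prod_right.const_mul _) ?_
  filter_upwards [hc] with y hy
  simp only [H, integral_mul_const]
  rw [← mul_assoc]
  exact mul_le_mul_of_nonneg_right hy (kern_nonneg hr y)

/-- The rotation `y ↦ -e^{iθ} y`. The sign turns `a - y`, as in convolutions, into
`a + e^{iθ} y`. -/
noncomputable def negRotation (k : ℕ) (θ : ℝ) : Cn k ≃ₗᵢ[ℝ] Cn k where
  toLinearEquiv := (LinearEquiv.smulOfNeZero ℂ (Cn k) (-circleMap 0 1 θ)
    (neg_ne_zero.2 (circleMap_ne_center one_ne_zero))).restrictScalars ℝ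
  norm_map' y := by simp [norm_smul]

lemma negRotation_apply (θ : ℝ) (y : Cn k) :
    negRotation k θ y = -(circleMap 0 1 θ • y) := by
  rw [← neg_smul]
  rfl

section Mollify

variable {g : Cn k → EReal} {r : ℝ}

lemma IsPsh.measurable_toReal (hg : IsPsh g) : Measurable fun z => (g z).toReal :=
  measurable_ereal_toReal.comp hg.1.measurable

/-- Mollification by a radial kernel increases a plurisubharmonic function. -/
lemma IsPsh.toReal_le_mollify (hg : IsPsh g) (hr : 0 < r) {a : Cn k} (ha : g a ≠ ⊥) :
    (g a).toReal ≤ mollify r (fun z => (g z).toReal) a := by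
  obtain ⟨hu, ht, hb, hl, hs⟩ := id hg
  set G : Cn k → ℝ := fun z => (g z).toReal
  have hrot : ∀ (F : Cn k → ℝ) (θ : ℝ), (fun y => F (a + circleMap 0 1 θ • y) * kern k r y)
      = (fun z => F (a - z) * kern k r z) ∘ negRotation k θ := by
    intro F θ
    ext y
    simp only [Function.comp_apply, negRotation_apply, sub_neg_eq_add]
    rw [kern_congr r (x := -(circleMap 0 1 θ • y)) (y := y) (by
      rw [norm_neg, norm_circleMap_smul])]
  have hint : ∀ (F : Cn k → ℝ) (θ : ℝ), ∫ y, F (a + circleMap 0 1 θ • y) * kern k r y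
      = ∫ z, F (a - z) * kern k r z := by
    intro F θ
    rw [hrot]
    exact (negRotation k θ).measurePreserving.integral_comp
      (negRotation k θ).toHomeomorph.measurableEmbedding (fun z => F (a - z) * kern k r z)
  have h := integral_mul_kern_le hg.measurable_toReal hr
    (p := fun θ y => a + circleMap 0 1 θ • y) (c := fun _ => G a)
    (continuous_const.add (((continuous_circleMap 0 1).comp continuous_fst).smul continuous_snd))
    (fun θ => by
      have := hrot G θ
      simp only [G] at this
      rw [this]
      exact (negRotation k θ).measurePreserving.integrable_comp_of_integrable
        (integrable_mollify hr hl a))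
    (by
      have : (fun θ => ∫ y, |G (a + circleMap 0 1 θ • y)| * kern k r y)
          = fun _ => ∫ z, |G (a - z)| * kern k r z := by
        ext θ; exact hint (fun z => |G z|) θ
      simp only [G] at this
      rw [this]
      exact continuous_const)
    ((integrable_kern hr).const_mul _)
    (ae_of_all _ fun y => by
      have := (hs a y ha).2.2
      rwa [Real.circleAverage_def, smul_eq_mul] at this)
  have h2 : ∀ θ, ∫ y, G (a + circleMap 0 1 θ • y) * kern k r y = mollify r G a := fun θ => by
    rw [hint G θ, mollify, conv_eq_integral_sub]
  simp only [G] at h2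
  simp only [h2, intervalIntegral.integral_const, smul_eq_mul, sub_zero, integral_const_mul,
    integral_kern hr, mul_one] at h
  rwa [inv_mul_cancel_left₀ (by positivity)] at h

/-- The mollification of a plurisubharmonic function is plurisubharmonic. -/
lemma IsPsh.levi_mollify_nonneg (hg : IsPsh g) (hr : 0 < r) (a v : Cn k) :
    0 ≤ levi (mollify r (fun z => (g z).toReal)) a v := by
  obtain ⟨hu, ht, hb, hl, hs⟩ := id hg
  refine levi_nonneg_of_submean (contDiff_mollify hr hl) a (fun b => ?_) v
  set G : Cn k → ℝ := fun z => (g z).toReal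
  have hsub : ∀ (F : Cn k → ℝ) θ, mollify r F (a + circleMap 0 1 θ • b)
      = ∫ y, F (a - y + circleMap 0 1 θ • b) * kern k r y := by
    intro F θ
    rw [mollify, conv_eq_integral_sub]
    congr 1
    ext y
    rw [add_sub_right_comm]
  have hcont : Continuous fun θ => a + circleMap 0 1 θ • b :=
    continuous_const.add ((continuous_circleMap 0 1).smul continuous_const)
  have h := integral_mul_kern_le hg.measurable_toReal hr
    (p := fun θ y => a - y + circleMap 0 1 θ • b) (c := fun y => G (a - y))
    ((continuous_const.sub continuous_snd).add
      (((continuous_circleMap 0 1).comp continuous_fst).smul continuous_const))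
    (fun θ => by
      have := integrable_mollify hr hl (a + circleMap 0 1 θ • b)
      simpa only [add_sub_right_comm] using this)
    (by
      have := (contDiff_mollify (g := fun z => ‖G z‖) hr
        fun x => let ⟨s, hs, h⟩ := hl x; ⟨s, hs, h.norm⟩).continuous.comp hcont
      refine this.congr fun θ => ?_
      exact hsub (fun z => |G z|) θ)
    (integrable_mollify hr hl a)
    (by
      have h1 : ∀ᵐ y : Cn k, g (a - y) ≠ ⊥ :=
        (Measure.measurePreserving_sub_left volume a).quasiMeasurePreserving.ae hb
      filter_upwards [h1] with y hy
      have := (hs (a - y) b hy).2.2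
      rwa [Real.circleAverage_def, smul_eq_mul] at this)
  have e : mollify r G a = ∫ y, G (a - y) * kern k r y := by
    rw [mollify, conv_eq_integral_sub]
  rw [e]
  simp only [hsub]
  exact h

end Mollify

/-- Upper semicontinuity bounds the mollifications from above in the limit. -/
lemma IsPsh.eventually_mollify_le {g : Cn k → EReal} (hg : IsPsh g) {a : Cn k} {s : ℝ}
    (h : g a < s) : ∀ᶠ r in 𝓝[>] (0 : ℝ), mollify r (fun z => (g z).toReal) a ≤ s := by
  obtain ⟨d, hd, hd'⟩ := Metric.eventually_nhds_iff.1 (hg.1 a s h)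
  filter_upwards [Ioo_mem_nhdsGT hd] with r hr
  refine mollify_le hr.1 hg.2.2.2.1 ?_
  filter_upwards [hg.2.2.1] with t ht htr
  have h1 : g t < s := hd' (by
    rw [dist_comm, dist_eq_norm]
    exact htr.trans hr.2)
  have := EReal.coe_toReal (hg.2.1 t) ht
  rw [← this] at h1
  exact_mod_cast h1.le

/-- The potential of `ω` grows at most linearly, uniformly. -/
lemma pot_le_add (x t : Cn k) {r : ℝ} (hr : 0 ≤ r) (h : ‖x - t‖ ≤ r) : pot k t ≤ pot k x + r := by
  have h1 : ‖t‖ ≤ ‖x‖ + r := by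
    have := norm_sub_norm_le t x
    rw [norm_sub_rev] at this
    linarith
  have h2 : 1 + ‖t‖ ^ 2 ≤ (1 + ‖x‖ ^ 2) * Real.exp r ^ 2 := by
    have h3 : 1 + r ≤ Real.exp r := by linarith [Real.add_one_le_exp r]
    calc 1 + ‖t‖ ^ 2 ≤ 1 + (‖x‖ + r) ^ 2 := by gcongr
      _ ≤ (1 + ‖x‖ ^ 2) * (1 + r) ^ 2 := by
        nlinarith [mul_nonneg hr (sq_nonneg (‖x‖ - 1)), mul_nonneg (sq_nonneg r) (sq_nonneg ‖x‖),
          norm_nonneg x, mul_nonneg hr (sq_nonneg ‖x‖)]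
      _ ≤ _ := by gcongr
  have h4 := Real.log_le_log (by positivity) h2
  rw [Real.log_mul (by positivity) (by positivity), Real.log_pow, Real.log_exp] at h4
  simp only [pot]
  push_cast at h4
  linarith

/-- Functions of the class `𝓕₀` are approximated by smooth nonpositive functions `φ r` with
`dd^c φ r ≥ -ω`, which up to `r` are larger: `φ r` is the mollification of the plurisubharmonic
function `ψ + pot`, minus `pot + r`. Subtracting `r` makes it nonpositive, by `pot_le_add`. -/
lemma exists_regularization {ψ : Cn k → EReal} (hψ : ψ ∈ classF₀ k) :
    ∃ φ : ℝ → Cn k → ℝ,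
      (∀ r, 0 < r → ContDiff ℝ ∞ (φ r) ∧ (∀ z, φ r z ≤ 0) ∧
        (∀ z v, -levi (pot k) z v ≤ levi (φ r) z v) ∧ ∀ z, ψ z ≤ ((φ r z + r : ℝ) : EReal)) ∧
      ∀ z (s : ℝ), ψ z < s → ∀ᶠ r in 𝓝[>] (0 : ℝ), φ r z ≤ s := by
  obtain ⟨Φ, ⟨hpsh, -, hmax⟩, rfl⟩ := hψ
  set ψ : Cn k → EReal := fun z => Φ (affinePoint 0 z)
  have hψ0 : ∀ z, ψ z ≤ 0 := fun z => hmax ⟨_, rfl⟩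
  have hg : IsPsh fun z : Cn k => ψ z + (pot k z : EReal) := hpsh 0
  set g : Cn k → EReal := fun z => ψ z + (pot k z : EReal)
  have hl : LocallyIntegrable fun z => (g z).toReal := hg.2.2.2.1
  refine ⟨fun r z => mollify r (fun z => (g z).toReal) z - pot k z - r,
    fun r hr => ⟨?_, ?_, ?_, ?_⟩, ?_⟩
  · exact ((contDiff_mollify hr hl).sub (contDiff_pot k)).sub contDiff_const
  · intro z
    have h : mollify r (fun z => (g z).toReal) z ≤ pot k z + r := by
      refine mollify_le hr hl ?_
      filter_upwards [hg.2.2.1] with t ht htr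
      refine le_trans ?_ (pot_le_add z t hr.le htr.le)
      have h1 : g t ≤ (pot k t : EReal) := by
        have := add_le_add_left (hψ0 t) (pot k t : EReal)
        rwa [zero_add] at this
      exact EReal.toReal_le_toReal h1 ht (EReal.coe_ne_top _)
    linarith
  · intro z v
    rw [levi_sub_const, levi_sub (contDiff_mollify hr hl) (contDiff_pot k)]
    linarith [hg.levi_mollify_nonneg hr z v]
  · intro z
    by_cases hz : ψ z = ⊥
    · rw [hz]; exact bot_le
    have hz' : ψ z ≠ ⊤ := ne_top_of_le_ne_top EReal.zero_ne_top (hψ0 z)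
    lift ψ z to ℝ using ⟨hz', hz⟩ with y hy
    have h1 : g z = ((y + pot k z : ℝ) : EReal) := by
      simp only [g, ← hy, EReal.coe_add]
    have h2 := hg.toReal_le_mollify hr (a := z) (by rw [h1]; exact EReal.coe_ne_bot _)
    rw [h1, EReal.toReal_coe] at h2
    norm_cast
    linarith
  · intro z s hs
    have h1 : g z < ((s + pot k z : ℝ) : EReal) := by
      rw [EReal.coe_add]
      exact EReal.add_lt_add_right_coe hs _
    filter_upwards [hg.eventually_mollify_le h1, self_mem_nhdsWithin] with r hr hr0
    have : 0 < r := hr0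
    linarith

end Psh

/-! ### Hölder continuous functions -/

section Hoelder

variable {k : ℕ} {ε ρ : ℝ}

lemma norm_rpow_triangle (hρ : 0 < ρ) (hρ1 : ρ < 1) (x y z : Cn k) :
    ‖x - z‖ ^ ρ ≤ ‖x - y‖ ^ ρ + ‖y - z‖ ^ ρ :=
  (Real.rpow_le_rpow (norm_nonneg _) (norm_sub_le_norm_sub_add_norm_sub x y z) hρ.le).trans
    (Real.rpow_add_le_add_rpow (norm_nonneg _) (norm_nonneg _) hρ.le hρ1.le)

/-- A Hölder continuous function on a set extends to the whole space with the same constant, by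
McShane's formula for the metric `‖x - y‖ ^ ρ`. -/
lemma exists_hoelder_extension {s : Set (Cn k)} (hs : s.Nonempty) (hε : 0 ≤ ε) (hρ : 0 < ρ)
    (hρ1 : ρ < 1) {u : Cn k → ℝ} (hu : ∀ x ∈ s, ∀ y ∈ s, |u x - u y| ≤ ε * ‖x - y‖ ^ ρ) :
    ∃ v : Cn k → ℝ, (∀ x ∈ s, v x = u x) ∧ ∀ x y, |v x - v y| ≤ ε * ‖x - y‖ ^ ρ := by
  have : Nonempty s := hs.to_subtype
  have hlow : ∀ x, ∀ y₀ ∈ s, ∀ y : s,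
      u y₀ - ε * ‖x - y₀‖ ^ ρ ≤ u y + ε * ‖x - (y : Cn k)‖ ^ ρ := fun x y₀ h₀ y => by
    have h1 := (abs_le.1 (hu y₀ h₀ y y.2)).2
    have h2 := mul_le_mul_of_nonneg_left (norm_rpow_triangle hρ hρ1 y₀ x y) hε
    rw [norm_sub_rev y₀ x] at h2
    linarith
  have hbdd : ∀ x, BddBelow (range fun y : s => u y + ε * ‖x - (y : Cn k)‖ ^ ρ) := fun x => by
    obtain ⟨y₀, h₀⟩ := hs
    exact ⟨u y₀ - ε * ‖x - y₀‖ ^ ρ, by rintro _ ⟨y, rfl⟩; exact hlow x y₀ h₀ y⟩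
  have hz : (0 : ℝ) ^ ρ = 0 := Real.zero_rpow hρ.ne'
  have hle : ∀ x x', (⨅ y : s, u y + ε * ‖x - (y : Cn k)‖ ^ ρ)
      ≤ (⨅ y : s, u y + ε * ‖x' - (y : Cn k)‖ ^ ρ) + ε * ‖x - x'‖ ^ ρ := fun x x' => by
    rw [← sub_le_iff_le_add]
    refine le_ciInf fun y => ?_
    have h1 := ciInf_le (hbdd x) y
    have h2 := mul_le_mul_of_nonneg_left (norm_rpow_triangle hρ hρ1 x x' y) hε
    linarith
  refine ⟨fun x => ⨅ y : s, u y + ε * ‖x - (y : Cn k)‖ ^ ρ, fun x hx => le_antisymm ?_ ?_,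
    fun x x' => ?_⟩
  · have := ciInf_le (hbdd x) ⟨x, hx⟩
    simpa [hz] using this
  · refine le_ciInf fun y => ?_
    have := hlow x x hx y
    simpa [hz] using this
  · have h1 := hle x x'
    have h2 := hle x' x
    rw [norm_sub_rev] at h2
    rw [abs_le]
    constructor <;> linarith

lemma continuous_of_hoelder (hρ : 0 < ρ) {u : Cn k → ℝ}
    (hu : ∀ x y, |u x - u y| ≤ ε * ‖x - y‖ ^ ρ) : Continuous u := by
  refine continuous_iff_continuousAt.2 fun x => ?_
  rw [ContinuousAt, tendsto_iff_dist_tendsto_zero]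
  have h : Continuous fun y => ε * ‖y - x‖ ^ ρ :=
    continuous_const.mul
      ((continuous_id.sub continuous_const).norm.rpow_const fun _ => Or.inr hρ.le)
  have h0 := h.tendsto x
  simp only [sub_self, norm_zero, Real.zero_rpow hρ.ne', mul_zero] at h0
  exact squeeze_zero (fun _ => dist_nonneg) (fun y => hu y x) h0

lemma abs_mollify_sub_self_le (hε : 0 ≤ ε) (hρ : 0 < ρ) {u : Cn k → ℝ}
    (hu : ∀ x y, |u x - u y| ≤ ε * ‖x - y‖ ^ ρ) {r : ℝ} (hr : 0 < r) (x : Cn k) :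
    |mollify r u x - u x| ≤ ε * r ^ ρ := by
  refine abs_mollify_sub_le hr (continuous_of_hoelder hρ hu).locallyIntegrable fun t ht => ?_
  rw [abs_sub_comm]
  refine (hu x t).trans ?_
  gcongr

/-- The mollifications at the scales `1 / (n + 1)` converge uniformly. -/
lemma tendstoUniformly_mollify (hε : 0 ≤ ε) (hρ : 0 < ρ) {u : Cn k → ℝ}
    (hu : ∀ x y, |u x - u y| ≤ ε * ‖x - y‖ ^ ρ) :
    TendstoUniformly (fun n : ℕ => mollify (1 / ((n : ℝ) + 1)) u) u atTop := by
  rw [Metric.tendstoUniformly_iff]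
  intro e he
  have h1 : Tendsto (fun n : ℕ => ε * (1 / ((n : ℝ) + 1)) ^ ρ) atTop (𝓝 (ε * 0 ^ ρ)) :=
    (tendsto_one_div_add_atTop_nhds_zero_nat.rpow_const (Or.inr hρ.le)).const_mul ε
  rw [Real.zero_rpow hρ.ne', mul_zero] at h1
  filter_upwards [h1.eventually_lt_const he] with n hn x
  rw [dist_comm, Real.dist_eq]
  exact (abs_mollify_sub_self_le hε hρ hu (by positivity) x).trans_lt hn

/-- A Hölder continuous function is within `2 ε δ^ρ` of a smooth function with second derivatives at
most `2 ε δ^(ρ - 2)`, and Levi form at most twice that. It is obtained by mollifying the infimal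
convolution with the paraboloid `ε δ^(ρ - 2) ‖z‖²`, which is semiconcave with a constant independent
of the dimension. -/
lemma exists_semiconcave_approx (hε : 0 ≤ ε) (hρ : 0 < ρ) (hρ1 : ρ < 1) {u : Cn k → ℝ}
    (hu : ∀ x y, |u x - u y| ≤ ε * ‖x - y‖ ^ ρ) {δ : ℝ} (hδ : 0 < δ) :
    ∃ w : Cn k → ℝ, ContDiff ℝ ∞ w ∧ (∀ x, |u x - w x| ≤ 2 * (ε * δ ^ ρ)) ∧
      ∀ x v, levi w x v ≤ 4 * (ε * δ ^ (ρ - 2)) * ‖v‖ ^ 2 := by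
  set K := ε * δ ^ (ρ - 2)
  have hlow : ∀ x z, u x - ε * δ ^ ρ ≤ u (x - z) + K * ‖z‖ ^ 2 := by
    intro x z
    have h1 := (abs_le.1 (hu x (x - z))).2
    rw [sub_sub_cancel] at h1
    have h2 : ‖z‖ ^ ρ ≤ δ ^ ρ + δ ^ (ρ - 2) * ‖z‖ ^ 2 := by
      rcases le_or_gt ‖z‖ δ with h | h
      · have := Real.rpow_le_rpow (norm_nonneg z) h hρ.le
        have : 0 ≤ δ ^ (ρ - 2) * ‖z‖ ^ 2 := by positivity
        linarith
      · have h3 : ‖z‖ ^ ρ = ‖z‖ ^ (ρ - 2) * ‖z‖ ^ 2 := by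
          rw [← Real.rpow_natCast, ← Real.rpow_add (hδ.trans h)]
          norm_num
        have h4 : ‖z‖ ^ (ρ - 2) ≤ δ ^ (ρ - 2) :=
          Real.rpow_le_rpow_of_nonpos hδ h.le (by linarith)
        have h5 : 0 ≤ δ ^ ρ := by positivity
        rw [h3]
        nlinarith [sq_nonneg ‖z‖]
    have h3 := mul_le_mul_of_nonneg_left h2 hε
    simp only [K]
    linarith
  set q : Cn k → ℝ := fun x => ⨅ z : Cn k, u (x - z) + K * ‖z‖ ^ 2
  have hbdd : ∀ x, BddBelow (range fun z : Cn k => u (x - z) + K * ‖z‖ ^ 2) := fun x =>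
    ⟨_, by rintro _ ⟨z, rfl⟩; exact hlow x z⟩
  have hqle : ∀ x z, q x ≤ u (x - z) + K * ‖z‖ ^ 2 := fun x z => ciInf_le (hbdd x) z
  have hq_le : ∀ x, q x ≤ u x := fun x => by simpa using hqle x 0
  have hq_ge : ∀ x, u x - ε * δ ^ ρ ≤ q x := fun x => le_ciInf (hlow x)
  have hq1 : ∀ x y, q x ≤ q y + ε * ‖x - y‖ ^ ρ := fun x y => by
    rw [← sub_le_iff_le_add]
    refine le_ciInf fun z => ?_
    have h1 := hqle x z
    have h2 := (abs_le.1 (hu (x - z) (y - z))).2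
    rw [sub_sub_sub_cancel_right] at h2
    linarith
  have hq : ∀ x y, |q x - q y| ≤ ε * ‖x - y‖ ^ ρ := fun x y => by
    have h1 := hq1 x y
    have h2 := hq1 y x
    rw [norm_sub_rev] at h2
    rw [abs_le]
    constructor <;> linarith
  have hq2 : ∀ w x : Cn k, q (x + w) + q (x - w) - 2 * q x ≤ 2 * K * ‖w‖ ^ 2 := by
    intro w x
    have h1 : (q (x + w) + q (x - w) - 2 * K * ‖w‖ ^ 2) / 2 ≤ q x := by
      refine le_ciInf fun z => ?_
      have h2 := hqle (x + w) (z + w)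
      have h3 := hqle (x - w) (z - w)
      rw [add_sub_add_right_eq_sub] at h2
      rw [sub_sub_sub_cancel_right] at h3
      have h4 := parallelogram_law_with_norm ℝ z w
      have h5 : K * ‖z + w‖ ^ 2 + K * ‖z - w‖ ^ 2 = 2 * K * ‖z‖ ^ 2 + 2 * K * ‖w‖ ^ 2 := by
        linear_combination K * h4
      linarith
    linarith
  have hql : LocallyIntegrable q := (continuous_of_hoelder hρ hq).locallyIntegrable
  have hw : ContDiff ℝ ∞ (mollify δ q) := contDiff_mollify hδ hql
  refine ⟨mollify δ q, hw, fun x => ?_, fun x v => ?_⟩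
  · have h1 := abs_le.1 (abs_mollify_sub_self_le hε hρ hq hδ x)
    have h2 := hq_le x
    have h3 := hq_ge x
    rw [abs_le]
    constructor <;> linarith
  · have h : ∀ v, fderiv ℝ (fderiv ℝ (mollify δ q)) x v v ≤ 2 * K * ‖v‖ ^ 2 := by
      intro v
      refine fderiv_fderiv_le_of_second_difference hw x v fun t => ?_
      refine (mollify_second_difference_le hδ hql (hq2 (t • v)) x).trans_eq ?_
      rw [norm_smul, mul_pow, Real.norm_eq_abs, sq_abs]
      ring
    have h1 := h v
    have h2 := h (J k v)
    rw [norm_J] at h2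
    rw [levi]
    linarith

end Hoelder

/-! ### Positivity of `dd^c (uT)` -/

section Positivity

variable {k : ℕ} {U : Opens (Cn k)}

/-- The mollification of a function with `dd^c u ≥ 0` in the sense of currents has a nonnegative
Levi form. -/
lemma DdcNonneg.levi_mollify_nonneg {u : Cn k → ℝ} (hu : DdcNonneg U u)
    (hl : LocallyIntegrable u) {r : ℝ} (hr : 0 < r) {x : Cn k}
    (hx : Metric.closedBall x r ⊆ U) (v : Cn k) : 0 ≤ levi (mollify r u) x v := by
  have hsupp : ∀ y, y ∉ Metric.closedBall x r → kern k r (x - y) = 0 := fun y hy => by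
    refine kern_eq_zero hr ?_
    rw [Metric.mem_closedBall, dist_comm, dist_eq_norm, not_le] at hy
    exact hy.le
  have hκ : ContDiff ℝ ∞ fun y => kern k r (x - y) :=
    (contDiff_kern k r).comp (contDiff_const.sub contDiff_id)
  let f : 𝓓(U, ℝ) :=
    { toFun := fun y => kern k r (x - y)
      contDiff' := hκ
      hasCompactSupport' := HasCompactSupport.intro (isCompact_closedBall x r) hsupp
      tsupport_subset' := (closure_minimal (fun y hy => by
        by_contra h
        exact hy (hsupp y h)) Metric.isClosed_closedBall).trans hx }
  have h := hu f (fun y => kern_nonneg hr _) v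
  have e : ∀ y, u y * ddc f y ![v, J k v]
      = 1 / (2 * Real.pi) * (u y * levi (kern k r) (x - y) v) := by
    intro y
    rw [ddc_apply_J f.contDiff]
    change u y * (1 / (2 * Real.pi) * levi (fun y => kern k r (x - y)) y v) = _
    rw [levi_comp_sub (contDiff_kern k r)]
    ring
  simp only [e] at h
  rw [integral_const_mul] at h
  rw [mollify, levi_conv hl (contDiff_kern k r) (hasCompactSupport_kern hr)]
  exact nonneg_of_mul_nonneg_right h (by positivity)

/-- `dd^c (uT)` is positive: it is the limit of `(dd^c u_n) ∧ T` for mollifications `u_n` of `u`. -/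
lemma ddcCurrent_nonneg {T S : Current U} (hb : HasBidegree T) (hT : IsPositive T)
    (hc : IsClosedCurrent T) {u : Cn k → ℝ} (hu : DdcNonneg U u) (hl : LocallyIntegrable u)
    (hS : IsProduct u T S)
    (hlim : TendstoUniformly (fun n : ℕ => mollify (1 / ((n : ℝ) + 1)) u) u atTop)
    (f : 𝓓(U, ℝ)) (hf : ∀ x, 0 ≤ f x) : 0 ≤ ddcCurrent S f := by
  have hun : ∀ n : ℕ, ContDiff ℝ ∞ (mollify (1 / ((n : ℝ) + 1)) u) := fun n =>
    contDiff_mollify (by positivity) hl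
  have h := hS _ hun hlim.tendstoUniformlyOn.tendstoLocallyUniformlyOn (ddcTest f)
  refine ge_of_tendsto h ?_
  obtain ⟨d, hd, hdU⟩ := f.hasCompactSupport.isCompact.exists_cthickening_subset_open U.isOpen
    f.tsupport_subset
  filter_upwards [tendsto_one_div_add_atTop_nhds_zero_nat.eventually_lt_const hd] with n hn
  rw [apply_smulTest_ddcTest hb hc]
  refine hT _ fun x => ⟨(isOneOne_ddc (hun n) x).smul _, fun v => ?_⟩
  rw [testSmul_apply, ContinuousAlternatingMap.smul_apply, smul_eq_mul, ddc_apply_J (hun n)]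
  by_cases hx : x ∈ tsupport f
  · have h1 := hu.levi_mollify_nonneg hl (r := 1 / ((n : ℝ) + 1)) (by positivity) (x := x)
      ((Metric.closedBall_subset_closedBall hn.le).trans
        ((Metric.closedBall_subset_cthickening hx d).trans hdU)) v
    have := hf x
    positivity
  · rw [image_eq_zero_of_notMem_tsupport hx, zero_mul]

end Positivity

/-! ### Logistic functions of a quasi-plurisubharmonic function -/

section Logistic

/-- The logistic function `1 / (1 + e^{α (t + M)})`, a smooth substitute for the indicator
function of `t < -M`. -/
noncomputable def logi (α M t : ℝ) : ℝ := (1 + Real.exp (α * (t + M)))⁻¹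

/-- A convex primitive of `1 - logi`, a smooth substitute for `max t (-M)`. It is normalized to be
nonpositive for `t ≤ 0`. -/
noncomputable def softMax (α M t : ℝ) : ℝ :=
  1 / α * (Real.log (1 + Real.exp (α * (t + M))) - Real.log 2) - M

variable {α M : ℝ}

lemma logi_pos (t : ℝ) : 0 < logi α M t := by unfold logi; positivity

lemma logi_lt_one (t : ℝ) : logi α M t < 1 :=
  inv_lt_one_of_one_lt₀ (by linarith [Real.exp_pos (α * (t + M))])

lemma contDiff_logi : ContDiff ℝ ∞ (logi α M) := by
  refine ContDiff.inv ?_ fun t => by positivity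
  exact contDiff_const.add
    (Real.contDiff_exp.comp (contDiff_const.mul (contDiff_id.add contDiff_const)))

lemma contDiff_softMax : ContDiff ℝ ∞ (softMax α M) := by
  refine (contDiff_const.mul ((ContDiff.log ?_ fun t => by positivity).sub contDiff_const)).sub
    contDiff_const
  exact contDiff_const.add
    (Real.contDiff_exp.comp (contDiff_const.mul (contDiff_id.add contDiff_const)))

lemma hasDerivAt_one_add_exp (t : ℝ) :
    HasDerivAt (fun t => 1 + Real.exp (α * (t + M))) (α * Real.exp (α * (t + M))) t := by
  have h := ((((hasDerivAt_id t).add_const M).const_mul α).exp).const_add 1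
  refine h.congr_deriv ?_
  simp only [_root_.id]
  ring

lemma hasDerivAt_logi (t : ℝ) :
    HasDerivAt (logi α M) (-(α * (logi α M t * (1 - logi α M t)))) t := by
  refine ((hasDerivAt_one_add_exp t).inv (by positivity)).congr_deriv ?_
  have : (1 + Real.exp (α * (t + M))) ≠ 0 := by positivity
  unfold logi
  field_simp
  ring

lemma deriv_logi : deriv (logi α M) = fun t => -(α * (logi α M t * (1 - logi α M t))) :=
  funext fun t => (hasDerivAt_logi t).deriv

lemma deriv_deriv_logi (t : ℝ) : deriv (deriv (logi α M)) t
    = α ^ 2 * (logi α M t * (1 - logi α M t)) * (1 - 2 * logi α M t) := by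
  rw [deriv_logi]
  have h := hasDerivAt_logi (α := α) (M := M) t
  have h2 := ((h.mul (h.const_sub 1)).const_mul α).neg
  have h3 : deriv (fun t => -(α * (logi α M t * (1 - logi α M t)))) t = _ := h2.deriv
  rw [h3]
  ring

lemma hasDerivAt_softMax (hα : 0 < α) (t : ℝ) :
    HasDerivAt (softMax α M) (1 - logi α M t) t := by
  refine (((((hasDerivAt_one_add_exp t).log (by positivity)).sub_const (Real.log 2)).const_mul
    (1 / α)).sub_const M).congr_deriv ?_
  have : (1 + Real.exp (α * (t + M))) ≠ 0 := by positivity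
  unfold logi
  field_simp
  ring

lemma deriv_softMax (hα : 0 < α) : deriv (softMax α M) = fun t => 1 - logi α M t :=
  funext fun t => (hasDerivAt_softMax hα t).deriv

lemma deriv_deriv_softMax (hα : 0 < α) (t : ℝ) : deriv (deriv (softMax α M)) t
    = α * (logi α M t * (1 - logi α M t)) := by
  rw [deriv_softMax hα, ((hasDerivAt_logi t).const_sub 1).deriv]
  ring

lemma logi_le_exp (t : ℝ) : logi α M t ≤ Real.exp (-(α * M)) * Real.exp (-(α * t)) := by
  rw [← Real.exp_add, logi, show -(α * M) + -(α * t) = -(α * (t + M)) by ring, Real.exp_neg]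
  gcongr
  linarith

lemma half_le_logi (hα : 0 < α) {t : ℝ} (ht : t ≤ -M) : 1 / 2 ≤ logi α M t := by
  have h : Real.exp (α * (t + M)) ≤ 1 := Real.exp_le_one_iff.2
    (mul_nonpos_of_nonneg_of_nonpos hα.le (by linarith))
  rw [logi, one_div]
  gcongr
  linarith

lemma softMax_nonpos (hα : 0 < α) (hM : 0 ≤ M) {t : ℝ} (ht : t ≤ 0) : softMax α M t ≤ 0 := by
  have h1 : 1 + Real.exp (α * (t + M)) ≤ 2 * Real.exp (α * M) := by
    have h2 : Real.exp (α * (t + M)) ≤ Real.exp (α * M) := by gcongr; linarith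
    have h3 : 1 ≤ Real.exp (α * M) := Real.one_le_exp (by positivity)
    linarith
  have h4 := Real.log_le_log (by positivity) h1
  rw [Real.log_mul (by norm_num) (by positivity), Real.log_exp] at h4
  rw [softMax, sub_nonpos, one_div, inv_mul_le_iff₀ hα]
  linarith

lemma neg_softMax_le (hα : 0 < α) {t : ℝ} :
    -softMax α M t ≤ 1 / α * Real.exp (-(α * t)) := by
  have h1 : α * (t + M) ≤ Real.log (1 + Real.exp (α * (t + M))) := by
    rw [Real.le_log_iff_exp_le (by positivity)]
    linarith
  have h2 : -(α * t) + 1 ≤ Real.exp (-(α * t)) := Real.add_one_le_exp _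
  have h3 : Real.log 2 ≤ 1 := by linarith [Real.log_two_lt_d9]
  have h4 : -softMax α M t
      = 1 / α * (α * M + Real.log 2 - Real.log (1 + Real.exp (α * (t + M)))) := by
    unfold softMax
    field_simp
    ring
  rw [h4]
  gcongr
  linarith

variable {k : ℕ} {φ : Cn k → ℝ}

lemma levi_softMax (hα : 0 < α) (hφ : ContDiff ℝ ∞ φ) (x v : Cn k) :
    levi (fun y => softMax α M (φ y)) x v = (1 - logi α M (φ x)) * levi φ x v
      + α * (logi α M (φ x) * (1 - logi α M (φ x))) * gradSq φ x v := by
  rw [levi_comp contDiff_softMax hφ, deriv_deriv_softMax hα, deriv_softMax hα]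

/-- If `dd^c φ ≥ -ω`, then the same holds for the truncations of `φ`. -/
lemma levi_softMax_add_nonneg (hα : 0 < α) (hφ : ContDiff ℝ ∞ φ) (x v : Cn k)
    (h : -levi (pot k) x v ≤ levi φ x v) :
    0 ≤ levi (fun y => softMax α M (φ y)) x v + levi (pot k) x v := by
  rw [levi_softMax hα hφ]
  have h1 := logi_pos (α := α) (M := M) (φ x)
  have h2 := logi_lt_one (α := α) (M := M) (φ x)
  have h3 := gradSq_nonneg φ x v
  have h4 := levi_pot_nonneg x v
  set s := logi α M (φ x)
  have h5 : 0 ≤ (1 - s) * (levi φ x v + levi (pot k) x v) :=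
    mul_nonneg (by linarith) (by linarith)
  have h6 : 0 ≤ α * (s * (1 - s)) * gradSq φ x v :=
    mul_nonneg (mul_nonneg hα.le (mul_nonneg h1.le (by linarith))) h3
  nlinarith [mul_nonneg h1.le h4]

/-- Both functions `α softMax ± logi` are convex with derivative in `[0, α]`, so that composition
with `φ` preserves `dd^c φ ≥ -ω` up to the factor `α`. -/
lemma abs_levi_logi_le (hα : 0 < α) (hφ : ContDiff ℝ ∞ φ) (x v : Cn k)
    (h : -levi (pot k) x v ≤ levi φ x v) :
    |levi (fun y => logi α M (φ y)) x v|
      ≤ α * (levi (fun y => softMax α M (φ y)) x v + levi (pot k) x v) := by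
  rw [levi_softMax hα hφ, levi_comp contDiff_logi hφ, deriv_deriv_logi, deriv_logi]
  have h1 := logi_pos (α := α) (M := M) (φ x)
  have h2 := logi_lt_one (α := α) (M := M) (φ x)
  have h3 := gradSq_nonneg φ x v
  have h4 := levi_pot_nonneg x v
  set s := logi α M (φ x)
  set L := levi φ x v
  set P := levi (pot k) x v
  set G := gradSq φ x v
  have hs : 0 ≤ 1 - s := by linarith
  have hL : 0 ≤ L + P := by linarith
  have hG : 0 ≤ α * (s * (1 - s)) * G := by positivity
  have a1 : 0 ≤ (1 - s) * (1 - s) * (L + P) := by positivity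
  have a2 : 0 ≤ (1 - s) * (1 + s) * (L + P) := by positivity
  have a3 : 0 ≤ (1 - (1 - s) * (1 - s)) * P :=
    mul_nonneg (by nlinarith) h4
  have a4 : 0 ≤ (1 - (1 - s) * (1 + s)) * P :=
    mul_nonneg (by nlinarith) h4
  have a5 : 0 ≤ α * (s * (1 - s)) * G * (2 - 2 * s) := mul_nonneg hG (by linarith)
  have a6 : 0 ≤ α * (s * (1 - s)) * G * (2 * s) := mul_nonneg hG (by linarith)
  rw [abs_le]
  constructor
  · have := mul_nonneg hα.le (add_nonneg (add_nonneg a1 a3) a5)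
    linarith
  · have := mul_nonneg hα.le (add_nonneg (add_nonneg a2 a4) a6)
    linarith

lemma gradSq_logi_le (hα : 0 < α) (hφ : ContDiff ℝ ∞ φ) (x v : Cn k)
    (h : -levi (pot k) x v ≤ levi φ x v) :
    gradSq (fun y => logi α M (φ y)) x v
      ≤ α * (levi (fun y => softMax α M (φ y)) x v + levi (pot k) x v) := by
  rw [levi_softMax hα hφ, gradSq_comp contDiff_logi hφ, deriv_logi]
  have h1 := logi_pos (α := α) (M := M) (φ x)
  have h2 := logi_lt_one (α := α) (M := M) (φ x)
  have h3 := gradSq_nonneg φ x v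
  have h4 := levi_pot_nonneg x v
  set s := logi α M (φ x)
  set L := levi φ x v
  set P := levi (pot k) x v
  set G := gradSq φ x v
  have hs : 0 ≤ 1 - s := by linarith
  have hL : 0 ≤ L + P := by linarith
  have a1 : 0 ≤ α * ((1 - s) * (L + P)) := by positivity
  have a2 : 0 ≤ α * (s * P) := by positivity
  have a3 : 0 ≤ α ^ 2 * (s * (1 - s)) * G * (1 - s * (1 - s)) :=
    mul_nonneg (by positivity) (by nlinarith)
  nlinarith

end Logistic

/-! ### Radial cutoff functions -/

section Cutoff

/-- A radial cutoff function, equal to `1` for `‖x‖² ≤ a` and to `0` for `‖x‖² ≥ b`. -/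
noncomputable def cut (k : ℕ) (a b : ℝ) (x : Cn k) : ℝ :=
  Real.smoothTransition ((b - ‖x‖ ^ 2) / (b - a))

variable {k : ℕ} {a b : ℝ}

lemma contDiff_cut : ContDiff ℝ ∞ (cut k a b) :=
  Real.smoothTransition.contDiff.comp ((contDiff_const.sub contDiff_normSq).div_const _)

lemma cut_nonneg (x : Cn k) : 0 ≤ cut k a b x := Real.smoothTransition.nonneg _

lemma cut_le_one (x : Cn k) : cut k a b x ≤ 1 := Real.smoothTransition.le_one _

lemma cut_eq_one (hab : a < b) {x : Cn k} (hx : ‖x‖ ^ 2 ≤ a) : cut k a b x = 1 := by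
  apply Real.smoothTransition.one_of_one_le
  rw [one_le_div (by linarith)]
  linarith

lemma cut_eq_zero (hab : a < b) {x : Cn k} (hx : b ≤ ‖x‖ ^ 2) : cut k a b x = 0 := by
  apply Real.smoothTransition.zero_of_nonpos
  exact div_nonpos_of_nonpos_of_nonneg (by linarith) (by linarith)

lemma levi_eq_zero_of_eventually {f : Cn k → ℝ} {x : Cn k} (h : f =ᶠ[𝓝 x] fun _ => 0)
    (v : Cn k) : levi f x v = 0 := by
  have h1 : fderiv ℝ f =ᶠ[𝓝 x] fun _ => 0 := by
    refine h.fderiv.trans (Eventually.of_forall fun y => ?_)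
    simp
  rw [levi, h1.fderiv_eq]
  simp

/-- A product with a cutoff function vanishes near the points outside of the cutoff ball. -/
lemma cut_mul_eventually_zero (hab : a < b) (g : Cn k → ℝ) {x : Cn k} (hx : b < ‖x‖ ^ 2) :
    (fun y => cut k a b y * g y) =ᶠ[𝓝 x] fun _ => 0 := by
  have h : ∀ᶠ y : Cn k in 𝓝 x, b < ‖y‖ ^ 2 :=
    (continuous_norm.pow 2).continuousAt.eventually (lt_mem_nhds hx)
  filter_upwards [h] with y hy
  rw [cut_eq_zero hab hy.le, zero_mul]

/-- The derivatives of radial cutoff functions are bounded uniformly in the dimension. -/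
lemma exists_cut_bound (ha : 0 < a) (hab : a < b) :
    ∃ C : ℝ, 0 ≤ C ∧ ∀ (k : ℕ) (x v : Cn k), ‖x‖ ^ 2 ≤ b →
      |levi (cut k a b) x v| ≤ C * levi (pot k) x v ∧
        gradSq (cut k a b) x v ≤ C * levi (pot k) x v := by
  set q : ℝ → ℝ := fun s => Real.smoothTransition ((b - s) / (b - a))
  have hq : ContDiff ℝ ∞ q :=
    Real.smoothTransition.contDiff.comp ((contDiff_const.sub contDiff_id).div_const _)
  have hq1 : ContDiff ℝ ∞ (deriv q) := (contDiff_infty_iff_deriv.1 hq).2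
  have hq2 : ContDiff ℝ ∞ (deriv (deriv q)) := (contDiff_infty_iff_deriv.1 hq1).2
  obtain ⟨A, hA⟩ := (isCompact_Icc (a := 0) (b := b)).exists_bound_of_continuousOn
    hq1.continuous.continuousOn
  obtain ⟨B, hB⟩ := (isCompact_Icc (a := 0) (b := b)).exists_bound_of_continuousOn
    hq2.continuous.continuousOn
  have hA0 : 0 ≤ A := (norm_nonneg _).trans (hA 0 ⟨le_rfl, by linarith⟩)
  have hB0 : 0 ≤ B := (norm_nonneg _).trans (hB 0 ⟨le_rfl, by linarith⟩)
  have hb0 : 0 < b := ha.trans hab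
  set D := (1 + b) ^ 2 / 2
  have hD : 0 ≤ D := by positivity
  refine ⟨(4 * A + 4 * B * b + 4 * A ^ 2 * b) * D, by positivity, fun k x v hx => ?_⟩
  have hmem : ‖x‖ ^ 2 ∈ Icc 0 b := ⟨by positivity, hx⟩
  have h1 := hA _ hmem
  have h2 := hB _ hmem
  rw [Real.norm_eq_abs] at h1 h2
  have h3 := normSq_le_levi_pot x v hx
  have h4 := levi_pot_nonneg x v
  constructor
  · refine (abs_levi_radial_le hq x v hx h1 h2).trans ?_
    calc (4 * A + 4 * B * b) * ‖v‖ ^ 2 ≤ (4 * A + 4 * B * b + 4 * A ^ 2 * b) * ‖v‖ ^ 2 := by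
          have : 0 ≤ 4 * A ^ 2 * b * ‖v‖ ^ 2 := by positivity
          linarith
      _ ≤ (4 * A + 4 * B * b + 4 * A ^ 2 * b) * (D * levi (pot k) x v) := by gcongr
      _ = _ := by ring
  · have e : gradSq (cut k a b) x v
        = deriv q (‖x‖ ^ 2) ^ 2 * gradSq (fun y : Cn k => ‖y‖ ^ 2) x v :=
      gradSq_comp hq contDiff_normSq x v
    have h5 : deriv q (‖x‖ ^ 2) ^ 2 ≤ A ^ 2 := sq_le_sq' (abs_le.1 h1).1 (abs_le.1 h1).2
    rw [e]
    calc _ ≤ A ^ 2 * (4 * ‖x‖ ^ 2 * ‖v‖ ^ 2) := by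
          have := gradSq_normSq_le x v
          have := gradSq_nonneg (fun y : Cn k => ‖y‖ ^ 2) x v
          gcongr
      _ ≤ A ^ 2 * (4 * b * ‖v‖ ^ 2) := by gcongr
      _ ≤ (4 * A + 4 * B * b + 4 * A ^ 2 * b) * ‖v‖ ^ 2 := by
          have : 0 ≤ (4 * A + 4 * B * b) * ‖v‖ ^ 2 := by positivity
          linarith
      _ ≤ (4 * A + 4 * B * b + 4 * A ^ 2 * b) * (D * levi (pot k) x v) := by gcongr
      _ = _ := by ring

/-- The product of a cutoff function and a smooth function, as a test function. -/
noncomputable def cutTest {U : Opens (Cn k)} (hab : a < b)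
    (hU : {x : Cn k | ‖x‖ ^ 2 ≤ b} ⊆ U) (g : Cn k → ℝ) (hg : ContDiff ℝ ∞ g) : 𝓓(U, ℝ) where
  toFun x := cut k a b x * g x
  contDiff' := contDiff_cut.mul hg
  hasCompactSupport' := by
    refine HasCompactSupport.intro (isCompact_closedBall (0 : Cn k) (Real.sqrt b)) fun x hx => ?_
    rw [mem_closedBall_zero_iff, not_le] at hx
    rw [cut_eq_zero hab (Real.lt_sq_of_sqrt_lt hx).le, zero_mul]
  tsupport_subset' := by
    refine (closure_minimal (fun x hx => ?_)
      (isClosed_le contDiff_normSq.continuous continuous_const)).trans hU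
    by_contra h
    have h' : b < ‖x‖ ^ 2 := not_le.1 h
    refine hx ?_
    change cut k a b x * g x = 0
    rw [cut_eq_zero hab h'.le, zero_mul]

@[simp] lemma cutTest_apply {U : Opens (Cn k)} (hab : a < b)
    (hU : {x : Cn k | ‖x‖ ^ 2 ≤ b} ⊆ U) (g : Cn k → ℝ) (hg : ContDiff ℝ ∞ g) (x : Cn k) :
    cutTest hab hU g hg x = cut k a b x * g x := rfl

end Cutoff

/-! ### The estimate for smooth potentials -/

section Estimate

variable {k : ℕ} {U : Opens (Cn k)}

/-- The exponential integrability of `T ∧ ω`, for a single smooth `φ`, as a bound for the pairing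
with test functions. -/
lemma wedgeOmega_le {T : Current U} {μ : Measure (Cn k)} (hμ : IsMeasureOf (wedgeOmega T) μ)
    {φ : Cn k → ℝ} {α c : ℝ} (hc : 0 ≤ c)
    (hint : ∫⁻ z in U, ENNReal.ofReal (Real.exp (-(α * φ z))) ∂μ ≤ ENNReal.ofReal c)
    (f : 𝓓(U, ℝ)) (hf : ∀ x, 0 ≤ f x) {B : ℝ} (hB : 0 ≤ B)
    (h : ∀ x, f x ≤ B * Real.exp (-(α * φ x))) : wedgeOmega T f ≤ B * c := by
  rw [← hμ.2 f, integral_eq_lintegral_of_nonneg_ae (ae_of_all _ hf)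
    f.continuous.aestronglyMeasurable]
  refine ENNReal.toReal_le_of_le_ofReal (by positivity) ?_
  have e : ∫⁻ x, ENNReal.ofReal (f x) ∂μ = ∫⁻ x in U, ENNReal.ofReal (f x) ∂μ := by
    rw [← lintegral_indicator U.isOpen.measurableSet]
    congr 1
    ext1 x
    by_cases hx : x ∈ (U : Set (Cn k))
    · rw [indicator_of_mem hx]
    · rw [indicator_of_notMem hx,
        image_eq_zero_of_notMem_tsupport fun h => hx (f.tsupport_subset h), ENNReal.ofReal_zero]
  rw [e, ENNReal.ofReal_mul hB]
  calc ∫⁻ x in U, ENNReal.ofReal (f x) ∂μ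
      ≤ ∫⁻ x in U, ENNReal.ofReal B * ENNReal.ofReal (Real.exp (-(α * φ x))) ∂μ := by
        refine lintegral_mono fun x => ?_
        rw [← ENNReal.ofReal_mul hB]
        exact ENNReal.ofReal_le_ofReal (h x)
    _ = ENNReal.ofReal B * ∫⁻ x in U, ENNReal.ofReal (Real.exp (-(α * φ x))) ∂μ :=
        lintegral_const_mul' _ _ ENNReal.ofReal_ne_top
    _ ≤ _ := by gcongr

/-- The mass of `dd^c (uT)` on the set `φ < -M`, measured by a cutoff `f` of `logi α M φ`, in terms
of a scale `δ` at which `u` is regularized to `w`. In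
`⟨uT, dd^c f⟩ = ⟨wT, dd^c f⟩ + ⟨(u - w)T, dd^c f⟩` the first term is `⟨T ∧ dd^c w, f⟩`, where
`dd^c w ≤ δ ^ (ρ - 2) ω` up to a constant and `f ≤ e^{-α M} e^{-α φ}`. In the second one
`|u - w| ≤ δ ^ ρ` up to a constant, and `±dd^c f` is at most a combination of `ω` and
`dd^c (softMax α M φ)`, whose pairing with `T` is bounded by a second integration by parts. -/
lemma exists_ddcCurrent_logi_le {R : ℝ} (hR : 1 < R) :
    ∃ (b : ℝ) (hb : 1 < b) (A : ℝ), 0 < A ∧ ∀ {k : ℕ} {U : Opens (Cn k)}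
      (_ : Metric.ball (0 : Cn k) R ⊆ U), ∃ hbU : {x : Cn k | ‖x‖ ^ 2 ≤ b} ⊆ U,
      ∀ {ρ ε : ℝ} (_ : 0 < ρ) (_ : ρ < 1) (_ : 0 ≤ ε) {u : Cn k → ℝ}
        (_ : ∀ x y, |u x - u y| ≤ ε * ‖x - y‖ ^ ρ)
        {T S : Current U} (_ : HasBidegree T) (_ : IsPositive T) (_ : IsClosedCurrent T)
        (_ : IsProduct u T S) {c α : ℝ} (_ : 0 ≤ c) (_ : 0 < α) {μ : Measure (Cn k)}
        (_ : IsMeasureOf (wedgeOmega T) μ) {φ : Cn k → ℝ} (hφ : ContDiff ℝ ∞ φ)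
        (_ : ∀ x, φ x ≤ 0) (_ : ∀ x v, -levi (pot k) x v ≤ levi φ x v)
        (_ : ∫⁻ z in U, ENNReal.ofReal (Real.exp (-(α * φ z))) ∂μ ≤ ENNReal.ofReal c)
        {M δ : ℝ} (_ : 0 ≤ M) (_ : 0 < δ),
        ddcCurrent S (cutTest hb hbU (fun x => logi α M (φ x)) (contDiff_logi.comp hφ))
          ≤ A * c * ε * (δ ^ (ρ - 2) * Real.exp (-(α * M)) + δ ^ ρ * (1 + α)) := by
  -- squared radii of nested cutoff functions: `f` is supported in `‖x‖² ≤ b₁`, `χ` is equal to `1`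
  -- there and supported in `‖x‖² ≤ b₂`, and the third cutoff function is equal to `1` on the latter
  set b₁ := 1 + (R ^ 2 - 1) / 4 with hb₁
  set b₂ := 1 + (R ^ 2 - 1) / 2 with hb₂
  set b₃ := 1 + (R ^ 2 - 1) * (3 / 4) with hb₃
  have hR2 : 1 < R ^ 2 := by nlinarith
  have h01 : 1 < b₁ := by linarith
  have h12 : b₁ < b₂ := by linarith
  have h23 : b₂ < b₃ := by linarith
  have h3R : b₃ < R ^ 2 := by linarith
  obtain ⟨C₁, hC₁, hcut₁⟩ := exists_cut_bound one_pos h01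
  obtain ⟨C₂, hC₂, hcut₂⟩ := exists_cut_bound (by linarith : 0 < b₁) h12
  set D := (1 + b₁) ^ 2 / 2 with hD
  have hD0 : 0 ≤ D := by positivity
  refine ⟨b₁, h01, 4 * D + 6 * (C₁ + C₂ + 1), by positivity, fun {k U} hU => ?_⟩
  have hsub : ∀ b < R ^ 2, {x : Cn k | ‖x‖ ^ 2 ≤ b} ⊆ U := fun b hb x hx => hU (by
    rw [mem_ball_zero_iff]
    have hx' : ‖x‖ ^ 2 ≤ b := hx
    exact lt_of_pow_lt_pow_left₀ 2 (by linarith) (hx'.trans_lt hb))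
  have hU₁ := hsub b₁ (by linarith)
  have hU₂ := hsub b₂ (by linarith)
  have hU₃ := hsub b₃ h3R
  refine ⟨hU₁, fun {ρ ε} hρ hρ1 hε {u} hu {T S} hb hT hcl hS {c α} hc hα {μ} hμ {φ} hφ hφ0 hφl hint
    {M δ} hM hδ => ?_⟩
  have hpi : 0 < 1 / (2 * Real.pi) := by positivity
  have hσ : ContDiff ℝ ∞ fun x => softMax α M (φ x) := contDiff_softMax.comp hφ
  have hh : ContDiff ℝ ∞ fun x => logi α M (φ x) := contDiff_logi.comp hφ
  set f := cutTest h01 hU₁ (fun x => logi α M (φ x)) hh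
  have hf : ∀ x, f x = cut k 1 b₁ x * logi α M (φ x) := fun x => rfl
  have hf0 : ∀ x, 0 ≤ f x := fun x => mul_nonneg (cut_nonneg x) (logi_pos _).le
  set χ := cutTest h12 hU₂ (fun _ => 1) contDiff_const
  have hχ : (χ : Cn k → ℝ) = cut k b₁ b₂ := by
    ext x; simp [χ]
  have hχz : ∀ x v, b₂ < ‖x‖ ^ 2 → levi (cut k b₁ b₂) x v = 0 := fun x v hx => by
    have := cut_mul_eventually_zero h12 (fun _ => 1) hx
    simp only [mul_one] at this
    exact levi_eq_zero_of_eventually this v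
  have hfz : ∀ x v, b₁ < ‖x‖ ^ 2 → levi f x v = 0 := fun x v hx =>
    levi_eq_zero_of_eventually (cut_mul_eventually_zero h01 _ hx) v
  -- a positive form `θ` with `±dd^c f ≤ θ`
  set γ₁ := testSmul χ (ddc fun x => softMax α M (φ x)) (contDiff_ddc hσ)
  set γ₂ := testSmul χ (omega k) (contDiff_omega k)
  set θ := (2 * α) • γ₁ + (2 * α + 2 * C₁) • γ₂
  have hθ1 : ∀ x, IsOneOne (θ x) := fun x =>
    (((isOneOne_ddc hσ x).smul _).smul _).add (((omega_isOneOne x).smul _).smul _)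
  have hθv : ∀ x v, θ x ![v, J k v] = 1 / (2 * Real.pi) * (cut k b₁ b₂ x *
      (2 * α * (levi (fun x => softMax α M (φ x)) x v + levi (pot k) x v)
        + 2 * C₁ * levi (pot k) x v)) := fun x v => by
    simp only [θ, γ₁, γ₂, add_apply, smul_apply, testSmul_apply,
      ContinuousAlternatingMap.add_apply, ContinuousAlternatingMap.smul_apply, smul_eq_mul,
      ddc_apply_J hσ, omega_apply_J, hχ]
    ring
  have hle : ∀ x v, |ddcTest f x ![v, J k v]| ≤ θ x ![v, J k v] := by
    intro x v
    have hP := levi_pot_nonneg x v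
    have hσ0 := levi_softMax_add_nonneg (M := M) hα hφ x v (hφl x v)
    rw [ddcTest_apply, ddc_apply_J f.contDiff, hθv, abs_mul, abs_of_pos hpi]
    refine mul_le_mul_of_nonneg_left ?_ hpi.le
    rcases le_or_gt (‖x‖ ^ 2) b₁ with hx | hx
    · rw [cut_eq_one h12 hx, one_mul]
      have e : levi f x v = _ := levi_mul (f := cut k 1 b₁) (contDiff_cut) hh x v
      obtain ⟨a1, a2⟩ := hcut₁ k x v hx
      have a3 := abs_levi_logi_le (M := M) hα hφ x v (hφl x v)
      have a4 := gradSq_logi_le (M := M) hα hφ x v (hφl x v)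
      have a5 := abs_cross_le (cut k 1 b₁) (fun y => logi α M (φ y)) x v
      have a6 : |cut k 1 b₁ x * levi (fun y => logi α M (φ y)) x v|
          ≤ |levi (fun y => logi α M (φ y)) x v| := by
        rw [abs_mul, abs_of_nonneg (cut_nonneg x)]
        exact mul_le_of_le_one_left (abs_nonneg _) (cut_le_one x)
      have a7 : |logi α M (φ x) * levi (cut k 1 b₁) x v| ≤ |levi (cut k 1 b₁) x v| := by
        rw [abs_mul, abs_of_nonneg (logi_pos _).le]
        exact mul_le_of_le_one_left (abs_nonneg _) (logi_lt_one _).le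
      rw [e]
      refine (abs_add_le _ _).trans ((add_le_add_left (abs_add_le _ _) _).trans ?_)
      linarith
    · rw [hfz x v hx, abs_zero]
      have := cut_nonneg (a := b₁) (b := b₂) x
      positivity
  have hγ₂ : T γ₂ ≤ c := by
    have := wedgeOmega_le hμ hc hint χ (fun x => by rw [hχ]; exact cut_nonneg x) zero_le_one
      fun x => by
        rw [hχ, one_mul]
        exact (cut_le_one x).trans (Real.one_le_exp (by nlinarith [hφ0 x]))
    rwa [one_mul] at this
  -- after integration by parts, the derivatives fall on `χ`, and `-softMax` is at most
  -- `e^{-α φ} / α`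
  have hγ₁ : T γ₁ ≤ C₂ * (1 / α * c) := by
    rw [← apply_smulTest_ddcTest hb hcl hσ χ]
    set g := cutTest h23 hU₃ (fun x => -softMax α M (φ x)) hσ.neg
    have hg : ∀ x, g x = cut k b₂ b₃ x * -softMax α M (φ x) := fun x => rfl
    have hs : ∀ x, 0 ≤ -softMax α M (φ x) := fun x =>
      neg_nonneg.2 (softMax_nonpos hα hM (hφ0 x))
    have hddcχ : ∀ x v, ddc χ x ![v, J k v] = 1 / (2 * Real.pi) * levi (cut k b₁ b₂) x v :=
      fun x v => by rw [ddc_apply_J χ.contDiff, hχ]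
    have h1 : T (smulTest (fun x => softMax α M (φ x)) hσ (ddcTest χ))
        ≤ T (C₂ • testSmul g (omega k) (contDiff_omega k)) := by
      refine hT.mono (fun x => (isOneOne_ddc χ.contDiff x).smul _)
        (fun x => ((omega_isOneOne x).smul _).smul _) fun x v => ?_
      simp only [smul_apply, smulTest_apply, testSmul_apply, ddcTest_apply,
        ContinuousAlternatingMap.smul_apply, smul_eq_mul, hddcχ, omega_apply_J, hg]
      have hP := levi_pot_nonneg x v
      have hs' := hs x
      rcases le_or_gt (‖x‖ ^ 2) b₂ with hx | hx
      · rw [cut_eq_one h23 hx]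
        have a1 := (abs_le.1 (hcut₂ k x v hx).1).1
        have a2 : 0 ≤ 1 / (2 * Real.pi) * (-softMax α M (φ x)
            * (C₂ * levi (pot k) x v + levi (cut k b₁ b₂) x v)) :=
          mul_nonneg hpi.le (mul_nonneg hs' (by linarith))
        linarith
      · rw [hχz x v hx, mul_zero, mul_zero]
        have := cut_nonneg (a := b₂) (b := b₃) x
        positivity
    refine h1.trans ?_
    rw [map_smul, smul_eq_mul]
    refine mul_le_mul_of_nonneg_left ?_ hC₂
    refine wedgeOmega_le hμ hc hint g (fun x => mul_nonneg (cut_nonneg x) (hs x)) (by positivity)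
      fun x => ?_
    rw [hg]
    exact (mul_le_of_le_one_left (hs x) (cut_le_one x)).trans (neg_softMax_le hα)
  have hθ : T θ ≤ 2 * (C₁ + C₂ + α) * c := by
    have e : T θ = 2 * α * T γ₁ + (2 * α + 2 * C₁) * T γ₂ := by
      simp only [θ, map_add, map_smul, smul_eq_mul]
    have a1 : 2 * α * T γ₁ ≤ 2 * α * (C₂ * (1 / α * c)) := by gcongr
    have a2 : (2 * α + 2 * C₁) * T γ₂ ≤ (2 * α + 2 * C₁) * c := by gcongr
    have a3 : 2 * α * (C₂ * (1 / α * c)) = 2 * C₂ * c := by field_simp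
    rw [e]
    linarith
  -- the regularization of `u` at scale `δ`
  obtain ⟨w, hw, hwu, hwl⟩ := exists_semiconcave_approx hε hρ hρ1 hu hδ
  set K := ε * δ ^ (ρ - 2)
  have hK : 0 ≤ K := by positivity
  have hTw : T (smulTest w hw (ddcTest f)) ≤ 4 * K * D * (Real.exp (-(α * M)) * c) := by
    rw [apply_smulTest_ddcTest hb hcl hw f]
    have h1 : T (testSmul f (ddc w) (contDiff_ddc hw))
        ≤ T ((4 * K * D) • testSmul f (omega k) (contDiff_omega k)) := by
      refine hT.mono (fun x => (isOneOne_ddc hw x).smul _)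
        (fun x => ((omega_isOneOne x).smul _).smul _) fun x v => ?_
      simp only [smul_apply, testSmul_apply, ContinuousAlternatingMap.smul_apply, smul_eq_mul,
        ddc_apply_J hw, omega_apply_J]
      rcases le_or_gt (‖x‖ ^ 2) b₁ with hx | hx
      · have a1 := normSq_le_levi_pot x v hx
        have a2 : levi w x v ≤ 4 * K * (D * levi (pot k) x v) :=
          (hwl x v).trans (mul_le_mul_of_nonneg_left a1 (by positivity))
        have a3 := mul_le_mul_of_nonneg_left a2 (mul_nonneg (hf0 x) hpi.le)
        linarith
      · rw [hf, cut_eq_zero h01 hx.le]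
        simp
    refine h1.trans ?_
    rw [map_smul, smul_eq_mul]
    refine mul_le_mul_of_nonneg_left ?_ (by positivity)
    refine wedgeOmega_le hμ hc hint f hf0 (by positivity) fun x => ?_
    rw [hf]
    exact (mul_le_of_le_one_left (logi_pos _).le (cut_le_one x)).trans (logi_le_exp _)
  have hlim := tendstoUniformly_mollify hε hρ hu
  have hun : ∀ n : ℕ, ContDiff ℝ ∞ (mollify (1 / ((n : ℝ) + 1)) u) := fun n =>
    contDiff_mollify (by positivity) (continuous_of_hoelder hρ hu).locallyIntegrable
  have hSlim := hS _ hun hlim.tendstoUniformlyOn.tendstoLocallyUniformlyOn (ddcTest f)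
  refine le_of_tendsto hSlim ?_
  filter_upwards [tendsto_one_div_add_atTop_nhds_zero_nat.eventually_lt_const hδ] with n hn
  have hdiff : ∀ x, |mollify (1 / ((n : ℝ) + 1)) u x - w x| ≤ 3 * (ε * δ ^ ρ) := fun x => by
    have a1 := abs_mollify_sub_self_le hε hρ hu (r := 1 / ((n : ℝ) + 1)) (by positivity) x
    have a2 : ε * (1 / ((n : ℝ) + 1)) ^ ρ ≤ ε * δ ^ ρ := by gcongr
    have a3 := abs_sub_le (mollify (1 / ((n : ℝ) + 1)) u x) (u x) (w x)
    linarith [hwu x]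
  have h2 := (abs_le.1 (hT.abs_smulTest_le (fun x => isOneOne_ddc f.contDiff x) hθ1 hle
    ((hun n).sub hw) hdiff)).2
  rw [← smulTest_sub (hun n) hw, map_sub] at h2
  have h3 : 3 * (ε * δ ^ ρ) * T θ ≤ 3 * (ε * δ ^ ρ) * (2 * (C₁ + C₂ + α) * c) := by gcongr
  have h4 : T (smulTest _ (hun n) (ddcTest f))
      ≤ 4 * K * D * (Real.exp (-(α * M)) * c) + 3 * (ε * δ ^ ρ) * (2 * (C₁ + C₂ + α) * c) := by
    linarith
  refine h4.trans ?_
  have q1 : 0 ≤ c * ε * (δ ^ (ρ - 2) * Real.exp (-(α * M))) := by positivity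
  have q2 : 0 ≤ c * ε * δ ^ ρ := by positivity
  have q3 : 0 ≤ (C₁ + C₂ + 1) * (c * ε * (δ ^ (ρ - 2) * Real.exp (-(α * M)))) := by positivity
  have q4 : 0 ≤ D * (c * ε * δ ^ ρ) * (1 + α) := by positivity
  have q5 : 0 ≤ (C₁ + C₂) * α * (c * ε * δ ^ ρ) := by positivity
  simp only [K]
  linarith

/-- The exponential estimate for a smooth `φ`, by summing over the levels `-4n / (αρ)` of `φ`: there
`e^{-αρφ/4}` is about `e^n`, and the mass of `dd^c (uT)` is at most a multiple of `e^{-2n}`. -/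
lemma exists_lintegral_exp_le {R : ℝ} (hR : 1 < R) :
    ∃ A : ℝ, 0 < A ∧ ∀ {k : ℕ} {U : Opens (Cn k)}
      (_ : Metric.ball (0 : Cn k) R ⊆ U)
      {ρ ε : ℝ} (_ : 0 < ρ) (_ : ρ < 1) (_ : 0 ≤ ε) {u : Cn k → ℝ}
        (_ : ∀ x y, |u x - u y| ≤ ε * ‖x - y‖ ^ ρ)
        {T S : Current U} (_ : HasBidegree T) (_ : IsPositive T) (_ : IsClosedCurrent T)
        (_ : IsProduct u T S) {c α : ℝ} (_ : 0 ≤ c) (_ : 0 < α) {μ ν : Measure (Cn k)}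
        (_ : IsMeasureOf (wedgeOmega T) μ) (_ : IsMeasureOf (ddcCurrent S) ν)
        {φ : Cn k → ℝ} (_ : ContDiff ℝ ∞ φ)
        (_ : ∀ x, φ x ≤ 0) (_ : ∀ x v, -levi (pot k) x v ≤ levi φ x v)
        (_ : ∫⁻ z in U, ENNReal.ofReal (Real.exp (-(α * φ z))) ∂μ ≤ ENNReal.ofReal c),
        ∫⁻ z in Metric.closedBall (0 : Cn k) 1,
          ENNReal.ofReal (Real.exp (-(α * ρ / 4 * φ z))) ∂ν
            ≤ ENNReal.ofReal (A * c * ε * (2 + α)) := by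
  obtain ⟨b, hb, A, hA, h⟩ := exists_ddcCurrent_logi_le hR
  refine ⟨4 * Real.exp 1 * A, by positivity, fun {k U} hU {ρ ε} hρ hρ1 hε {u} hu {T S} hbi hT hcl hS
    {c α} hc hα {μ ν} hμ hν {φ} hφ hφ0 hφl hint => ?_⟩
  obtain ⟨hbU, h⟩ := h hU
  set β := α * ρ / 4 with hβ
  have hβ0 : 0 < β := by positivity
  have hsm : ∀ n : ℕ, ContDiff ℝ ∞ fun x => logi α (n / β) (φ x) := fun n => contDiff_logi.comp hφ
  set f : ℕ → 𝓓(U, ℝ) := fun n => cutTest hb hbU (fun x => logi α (n / β) (φ x)) (hsm n)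
  have hf : ∀ n x, f n x = cut k 1 b x * logi α (n / β) (φ x) := fun n x => rfl
  have hf0 : ∀ n x, 0 ≤ f n x := fun n x => mul_nonneg (cut_nonneg x) (logi_pos _).le
  -- the scale `δ = e^{-2n/ρ}` balances the two terms of the estimate at the level `M = n / β`
  have hfn : ∀ n : ℕ, ddcCurrent S (f n) ≤ A * c * ε * (2 + α) * Real.exp (-(2 * n)) := by
    intro n
    have h1 := h hρ hρ1 hε hu hbi hT hcl hS hc hα hμ hφ hφ0 hφl hint (M := n / β)
      (δ := Real.exp (-(2 * n / ρ))) (by positivity) (Real.exp_pos _)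
    have e1 : Real.exp (-(2 * n / ρ)) ^ ρ = Real.exp (-(2 * n)) := by
      rw [← Real.exp_mul]
      congr 1
      field_simp
    have e2 : Real.exp (-(2 * n / ρ)) ^ (ρ - 2) * Real.exp (-(α * (n / β)))
        = Real.exp (-(2 * n)) := by
      rw [← Real.exp_mul, ← Real.exp_add]
      congr 1
      rw [hβ]
      field_simp
      ring
    rw [e1, e2] at h1
    exact h1.trans_eq (by ring)
  have hint2 : ∀ n, ∫⁻ z in Metric.closedBall (0 : Cn k) 1, ENNReal.ofReal (f n z) ∂ν
      ≤ ENNReal.ofReal (A * c * ε * (2 + α) * Real.exp (-(2 * n))) := by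
    intro n
    have hfi : Integrable (f n) ν := by
      have h1 : IntegrableOn (f n) (tsupport (f n)) ν := by
        obtain ⟨B, hB⟩ := (f n).hasCompactSupport.exists_bound_of_continuous (f n).continuous
        exact IntegrableOn.of_bound
          (hν.1 _ (f n).hasCompactSupport (f n).tsupport_subset)
          (f n).continuous.aestronglyMeasurable B (ae_of_all _ hB)
      rwa [integrableOn_iff_integrable_of_support_subset (subset_tsupport _)] at h1
    calc _ ≤ ∫⁻ z, ENNReal.ofReal (f n z) ∂ν := setLIntegral_le_lintegral _ _
      _ = ENNReal.ofReal (∫ z, f n z ∂ν) :=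
        (ofReal_integral_eq_lintegral_ofReal hfi (ae_of_all _ (hf0 n))).symm
      _ ≤ _ := by
        rw [hν.2]
        exact ENNReal.ofReal_le_ofReal (hfn n)
  -- on the unit ball, the exponential is dominated by the term of index `⌊-β φ⌋`
  have hpt : ∀ z ∈ Metric.closedBall (0 : Cn k) 1, ENNReal.ofReal (Real.exp (-(β * φ z)))
      ≤ ∑' n : ℕ, ENNReal.ofReal (2 * Real.exp 1 * Real.exp n) * ENNReal.ofReal (f n z) := by
    intro z hz
    rw [mem_closedBall_zero_iff] at hz
    have hx : 0 ≤ -(β * φ z) := by nlinarith [hφ0 z]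
    set n := ⌊-(β * φ z)⌋₊
    refine le_trans ?_ (ENNReal.le_tsum n)
    rw [← ENNReal.ofReal_mul (by positivity)]
    refine ENNReal.ofReal_le_ofReal ?_
    have h1 : (n : ℝ) ≤ -(β * φ z) := Nat.floor_le hx
    have h2 : -(β * φ z) ≤ 1 + n := by
      rw [add_comm]
      exact (Nat.lt_floor_add_one _).le
    have h3 : 1 / 2 ≤ logi α (n / β) (φ z) := half_le_logi hα (by
      rw [le_neg, div_le_iff₀ hβ0]
      linarith)
    rw [hf, cut_eq_one hb (by nlinarith [norm_nonneg z]), one_mul]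
    calc Real.exp (-(β * φ z)) ≤ Real.exp (1 + n) := Real.exp_le_exp.2 h2
      _ = 2 * Real.exp 1 * Real.exp n * (1 / 2) := by rw [Real.exp_add]; ring
      _ ≤ _ := by gcongr
  have hgeo : HasSum (fun n : ℕ => Real.exp (-(n : ℝ))) (1 - Real.exp (-1))⁻¹ := by
    have := hasSum_geometric_of_lt_one (Real.exp_pos (-1)).le (Real.exp_lt_one_iff.2 (by norm_num))
    refine this.congr_fun fun n => ?_
    rw [← Real.exp_nat_mul]
    ring_nf
  have hgeo2 : (1 - Real.exp (-1))⁻¹ ≤ 2 := by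
    have h1 : 2 ≤ Real.exp 1 := by linarith [Real.add_one_le_exp 1]
    have h2 : Real.exp (-1) ≤ 1 / 2 := by
      rw [Real.exp_neg, one_div]
      gcongr
    rw [inv_le_comm₀ (by linarith) two_pos]
    linarith
  set Q := A * c * ε * (2 + α)
  have hQ : 0 ≤ Q := by positivity
  calc ∫⁻ z in Metric.closedBall (0 : Cn k) 1, ENNReal.ofReal (Real.exp (-(β * φ z))) ∂ν
      ≤ ∫⁻ z in Metric.closedBall (0 : Cn k) 1,
          ∑' n : ℕ, ENNReal.ofReal (2 * Real.exp 1 * Real.exp n) * ENNReal.ofReal (f n z) ∂ν :=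
        setLIntegral_mono' Metric.isClosed_closedBall.measurableSet hpt
    _ = ∑' n : ℕ, ENNReal.ofReal (2 * Real.exp 1 * Real.exp n)
          * ∫⁻ z in Metric.closedBall (0 : Cn k) 1, ENNReal.ofReal (f n z) ∂ν := by
        rw [lintegral_tsum fun n =>
          (((f n).continuous.measurable.ennreal_ofReal).const_mul _).aemeasurable]
        congr 1
        ext1 n
        exact lintegral_const_mul _ (f n).continuous.measurable.ennreal_ofReal
    _ ≤ ∑' n : ℕ, ENNReal.ofReal (2 * Real.exp 1 * Q * Real.exp (-(n : ℝ))) := by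
        refine ENNReal.tsum_le_tsum fun n => ?_
        refine (mul_le_mul_right (hint2 n) _).trans_eq ?_
        rw [← ENNReal.ofReal_mul (by positivity)]
        congr 1
        have : Real.exp (-(2 * (n : ℝ))) = Real.exp (-(n : ℝ)) * Real.exp (-(n : ℝ)) := by
          rw [← Real.exp_add]; ring_nf
        have h2 : Real.exp n * Real.exp (-(n : ℝ)) = 1 := by
          rw [← Real.exp_add]; simp
        rw [this]
        linear_combination (2 * Real.exp 1 * Q * Real.exp (-(n : ℝ))) * h2
    _ = ENNReal.ofReal (∑' n : ℕ, 2 * Real.exp 1 * Q * Real.exp (-(n : ℝ))) :=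
        (ENNReal.ofReal_tsum_of_nonneg (fun n => by positivity)
          (hgeo.mul_left (2 * Real.exp 1 * Q)).summable).symm
    _ ≤ ENNReal.ofReal (4 * Real.exp 1 * A * c * ε * (2 + α)) := by
        refine ENNReal.ofReal_le_ofReal ?_
        rw [(hgeo.mul_left (2 * Real.exp 1 * Q)).tsum_eq]
        calc 2 * Real.exp 1 * Q * (1 - Real.exp (-1))⁻¹ ≤ 2 * Real.exp 1 * Q * 2 := by gcongr
          _ = _ := by simp only [Q]; ring

end Estimate

/-! ### Passage to the limit -/

section Limit

variable {k : ℕ}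

/-- Fatou's lemma for approximations which are asymptotically bounded from above. -/
lemma exp_le_liminf {β : ℝ} (hβ : 0 < β) {ψ : EReal} (hψ : ψ ≠ ⊤) {a : ℕ → ℝ}
    (h : ∀ s : ℝ, ψ < s → ∀ᶠ n in atTop, a n ≤ s) :
    EReal.exp (((-β : ℝ) : EReal) * ψ)
      ≤ liminf (fun n => ENNReal.ofReal (Real.exp (-(β * a n)))) atTop := by
  have key : ∀ s : ℝ, ψ < s → ENNReal.ofReal (Real.exp (-(β * s)))
      ≤ liminf (fun n => ENNReal.ofReal (Real.exp (-(β * a n)))) atTop := fun s hs => by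
    refine le_liminf_of_le (by isBoundedDefault) ?_
    filter_upwards [h s hs] with n hn
    refine ENNReal.ofReal_le_ofReal (Real.exp_le_exp.2 ?_)
    have := mul_le_mul_of_nonneg_left hn hβ.le
    linarith
  induction ψ using EReal.rec with
  | bot =>
    have h1 : Tendsto (fun s : ℝ => ENNReal.ofReal (Real.exp (-(β * s)))) atBot (𝓝 ⊤) := by
      refine ENNReal.tendsto_ofReal_nhds_top.2 (Real.tendsto_exp_atTop.comp ?_)
      exact tendsto_neg_atBot_atTop.comp (tendsto_id.const_mul_atBot hβ)
    have h2 : EReal.exp (((-β : ℝ) : EReal) * ⊥) ≤ ⊤ := le_top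
    exact h2.trans (le_of_tendsto h1 (Eventually.of_forall fun s => key s (EReal.bot_lt_coe s)))
  | top => exact absurd rfl hψ
  | coe y =>
    have h1 : Tendsto (fun s : ℝ => ENNReal.ofReal (Real.exp (-(β * s)))) (𝓝[>] y)
        (𝓝 (ENNReal.ofReal (Real.exp (-(β * y))))) := by
      have : Continuous fun s : ℝ => ENNReal.ofReal (Real.exp (-(β * s))) :=
        ENNReal.continuous_ofReal.comp (by fun_prop : Continuous fun s : ℝ => Real.exp (-(β * s)))
      exact this.continuousAt.tendsto.mono_left nhdsWithin_le_nhds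
    have h2 : EReal.exp (((-β : ℝ) : EReal) * (y : EReal))
        = ENNReal.ofReal (Real.exp (-(β * y))) := by
      rw [← EReal.coe_mul, EReal.exp_coe, neg_mul]
    rw [h2]
    refine le_of_tendsto h1 ?_
    filter_upwards [self_mem_nhdsWithin] with s hs
    exact key s (by exact_mod_cast hs)

lemma ofReal_exp_le_exp {α : ℝ} (hα : 0 < α) {ψ : EReal} {y : ℝ} (h : ψ ≤ y) :
    ENNReal.ofReal (Real.exp (-(α * y))) ≤ EReal.exp (((-α : ℝ) : EReal) * ψ) := by
  induction ψ using EReal.rec with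
  | bot => rw [EReal.coe_mul_bot_of_neg (by linarith), EReal.exp_top]; exact le_top
  | top => simp at h
  | coe x =>
    rw [← EReal.coe_mul, EReal.exp_coe]
    refine ENNReal.ofReal_le_ofReal (Real.exp_le_exp.2 ?_)
    have : x ≤ y := by exact_mod_cast h
    nlinarith

lemma ddcTest_add {U : Opens (Cn k)} (f g : 𝓓(U, ℝ)) :
    ddcTest (f + g) = ddcTest f + ddcTest g := by
  have h : dc (f + g : Cn k → ℝ) = dc f + dc g := by
    ext x v
    simp only [Pi.add_apply, ContinuousAlternatingMap.add_apply, dc_apply]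
    rw [fderiv_add (f.contDiff.differentiable (by simp) x) (g.contDiff.differentiable (by simp) x)]
    simp only [add_apply]
    ring
  ext1 x
  change extDeriv (dc (f + g : Cn k → ℝ)) x = extDeriv (dc f) x + extDeriv (dc g) x
  rw [h, extDeriv_add ((contDiff_dc f.contDiff).differentiable (by simp) x)
    ((contDiff_dc g.contDiff).differentiable (by simp) x)]

lemma ddcTest_smul {U : Opens (Cn k)} (a : ℝ) (f : 𝓓(U, ℝ)) :
    ddcTest (a • f) = a • ddcTest f := by
  have h : dc (a • f : Cn k → ℝ) = a • dc f := by
    ext x v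
    simp only [Pi.smul_apply, ContinuousAlternatingMap.smul_apply, dc_apply, smul_eq_mul]
    rw [fderiv_const_smul (f.contDiff.differentiable (by simp) x)]
    simp only [smul_apply, smul_eq_mul]
    ring
  ext1 x
  change extDeriv (dc (a • f : Cn k → ℝ)) x = a • extDeriv (dc f) x
  rw [h, extDeriv_smul]

end Limit

end Moderate

open Moderate
theorem lemma2p10 (R : ℝ) (hR : 1 < R) :
    ∃ c₁ c₂ : ℝ, 0 < c₁ ∧ 0 < c₂ ∧
      ∀ (k : ℕ) (_ : 1 ≤ k) (U : Opens (Cn k)) (_ : Metric.ball (0 : Cn k) R ⊆ U)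
        (ρ ε : ℝ) (_ : 0 < ρ) (_ : ρ < 1)
        (u : Cn k → ℝ) (_ : ∀ x ∈ U, ∀ y ∈ U, |u x - u y| ≤ ε * ‖x - y‖ ^ ρ)
        (_ : DdcNonneg U u)
        (T : Current U) (_ : HasBidegree T) (_ : IsPositive T) (_ : IsClosedCurrent T)
        (c α : ℝ) (_ : 0 < c) (_ : 0 < α)
        (μ : Measure (Cn k)) (_ : IsMeasureOf (wedgeOmega T) μ) (_ : IsModerateOn U μ c α),
        ∃ (S : Current U) (ν : Measure (Cn k)), IsProduct u T S ∧ IsMeasureOf (ddcCurrent S) ν ∧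
          ∀ φ ∈ classF₀ k,
            ∫⁻ z in Metric.closedBall (0 : Cn k) 1,
                EReal.exp (((-(α * ρ / 4) : ℝ) : EReal) * φ z) ∂ν
              ≤ ENNReal.ofReal (c * k * ε * (c₁ * Real.exp α + c₂ / α)) := by
  obtain ⟨A, hA, hest⟩ := exists_lintegral_exp_le hR
  refine ⟨4 * A, 1, by positivity, one_pos, ?_⟩
  intro k hk U hU ρ ε hρ hρ1 u hu hddc T hbi hT hcl c α hc hα μ hμ hmod
  have h0U : (0 : Cn k) ∈ U := hU (Metric.mem_ball_self (by linarith))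
  -- `U` contains two points at distance `1`
  have hε : 0 ≤ ε := by
    have h1 : EuclideanSpace.single (⟨0, hk⟩ : Fin k) (1 : ℂ) ∈ U := hU (by
      rw [mem_ball_zero_iff]
      simpa using hR)
    have h2 := hu _ h1 _ h0U
    rw [sub_zero, PiLp.norm_single, norm_one, Real.one_rpow, mul_one] at h2
    exact (abs_nonneg _).trans h2
  obtain ⟨v, hvu, hv⟩ := exists_hoelder_extension ⟨0, h0U⟩ hε hρ hρ1 hu
  have hvl : LocallyIntegrable v := (continuous_of_hoelder hρ hv).locallyIntegrable
  have hvddc : DdcNonneg U v := fun f hf w => by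
    refine (hddc f hf w).trans_eq (integral_congr_ae (ae_of_all _ fun x => ?_))
    by_cases hx : x ∈ U
    · simp only [hvu x hx]
    · have h0 : ddcTest f x = 0 :=
        image_eq_zero_of_notMem_tsupport fun h => hx ((ddcTest f).tsupport_subset h)
      rw [ddcTest_apply] at h0
      simp [h0]
  have hlim := tendstoUniformly_mollify hε hρ hv
  obtain ⟨S, hS⟩ := exists_isProduct hbi hT (u := v)
    (un := fun n : ℕ => mollify (1 / ((n : ℝ) + 1)) v)
    (fun n => contDiff_mollify (by positivity) hvl)
    hlim.tendstoUniformlyOn.tendstoLocallyUniformlyOn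
  have hSu : IsProduct u T S := fun un hun h η => hS un hun (h.congr_right fun x hx =>
    (hvu x hx).symm) η
  let L : 𝓓(U, ℝ) →ₗ[ℝ] ℝ :=
    { toFun := ddcCurrent S
      map_add' := fun f g => by simp only [ddcCurrent, ddcTest_add, map_add]
      map_smul' := fun a f => by simp only [ddcCurrent, ddcTest_smul, map_smul, RingHom.id_apply] }
  obtain ⟨ν, hν⟩ := exists_isMeasureOf L fun f hf =>
    ddcCurrent_nonneg hbi hT hcl hvddc hvl hS hlim f hf
  refine ⟨S, ν, hSu, hν, fun ψ hψ => ?_⟩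
  obtain ⟨φ, hφ, hφlim⟩ := exists_regularization hψ
  have hψt : ∀ z, ψ z ≠ ⊤ := by
    obtain ⟨Φ, ⟨-, -, hmax⟩, rfl⟩ := hψ
    exact fun z => ne_top_of_le_ne_top EReal.zero_ne_top (hmax ⟨_, rfl⟩)
  set β := α * ρ / 4
  have hβ : 0 < β := by positivity
  set r : ℕ → ℝ := fun n => Real.log 2 / α * (1 / ((n : ℝ) + 1))
  have hlog : 0 < Real.log 2 := Real.log_pos one_lt_two
  have hr0 : ∀ n, 0 < r n := fun n => by positivity
  -- the loss `r n` in the regularization costs at most a factor `2` in the exponential integral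
  have hr1 : ∀ n, α * r n ≤ Real.log 2 := fun n => by
    have : 1 / ((n : ℝ) + 1) ≤ 1 := by
      rw [div_le_one (by positivity)]
      linarith [Nat.cast_nonneg (α := ℝ) n]
    calc α * r n = Real.log 2 * (1 / ((n : ℝ) + 1)) := by simp only [r]; field_simp
      _ ≤ Real.log 2 * 1 := by gcongr
      _ = _ := mul_one _
  have hrlim : Tendsto r atTop (𝓝[>] 0) := by
    refine tendsto_nhdsWithin_iff.2 ⟨?_, Eventually.of_forall hr0⟩
    have := tendsto_one_div_add_atTop_nhds_zero_nat (𝕜 := ℝ).const_mul (Real.log 2 / α)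
    rwa [mul_zero] at this
  have hint : ∀ n, ∫⁻ z in U, ENNReal.ofReal (Real.exp (-(α * φ (r n) z))) ∂μ
      ≤ ENNReal.ofReal (2 * c) := by
    intro n
    calc _ ≤ ∫⁻ z in U, ENNReal.ofReal 2 * EReal.exp (((-α : ℝ) : EReal) * ψ z) ∂μ := by
          refine lintegral_mono fun z => ?_
          have h1 := ofReal_exp_le_exp hα ((hφ (r n) (hr0 n)).2.2.2 z)
          refine le_trans ?_ (mul_le_mul_right h1 _)
          rw [← ENNReal.ofReal_mul two_pos.le]
          refine ENNReal.ofReal_le_ofReal ?_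
          rw [← Real.exp_log two_pos, ← Real.exp_add]
          refine Real.exp_le_exp.2 ?_
          linarith [hr1 n]
      _ = ENNReal.ofReal 2 * ∫⁻ z in U, EReal.exp (((-α : ℝ) : EReal) * ψ z) ∂μ :=
          lintegral_const_mul' _ _ ENNReal.ofReal_ne_top
      _ ≤ ENNReal.ofReal 2 * ENNReal.ofReal c := by
          gcongr
          exact hmod ψ hψ
      _ = _ := (ENNReal.ofReal_mul two_pos.le).symm
  have hn : ∀ n, ∫⁻ z in Metric.closedBall (0 : Cn k) 1,
      ENNReal.ofReal (Real.exp (-(β * φ (r n) z))) ∂ν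
        ≤ ENNReal.ofReal (A * (2 * c) * ε * (2 + α)) := fun n =>
    hest hU hρ hρ1 hε hv hbi hT hcl hS (by positivity) hα hμ hν (hφ _ (hr0 n)).1
      (hφ _ (hr0 n)).2.1 (hφ _ (hr0 n)).2.2.1 (hint n)
  calc ∫⁻ z in Metric.closedBall (0 : Cn k) 1, EReal.exp (((-β : ℝ) : EReal) * ψ z) ∂ν
      ≤ ∫⁻ z in Metric.closedBall (0 : Cn k) 1,
          liminf (fun n => ENNReal.ofReal (Real.exp (-(β * φ (r n) z)))) atTop ∂ν :=
        lintegral_mono fun z => exp_le_liminf hβ (hψt z) fun s hs =>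
          hrlim.eventually (hφlim z s hs)
    _ ≤ liminf (fun n => ∫⁻ z in Metric.closedBall (0 : Cn k) 1,
          ENNReal.ofReal (Real.exp (-(β * φ (r n) z))) ∂ν) atTop := by
        refine lintegral_liminf_le fun n => ?_
        have := (hφ _ (hr0 n)).1.continuous
        exact (by fun_prop :
          Continuous fun z => Real.exp (-(β * φ (r n) z))).measurable.ennreal_ofReal
    _ ≤ ENNReal.ofReal (A * (2 * c) * ε * (2 + α)) :=
        liminf_le_of_le (by isBoundedDefault) fun b hb => by
          obtain ⟨n, hn'⟩ := hb.exists
          exact hn'.trans (hn n)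
    _ ≤ _ := by
        refine ENNReal.ofReal_le_ofReal ?_
        have h1 : 2 + α ≤ 2 * Real.exp α := by linarith [Real.add_one_le_exp α]
        have h2 : (1 : ℝ) ≤ k := by exact_mod_cast hk
        calc A * (2 * c) * ε * (2 + α) ≤ A * (2 * c) * ε * (2 * Real.exp α) := by gcongr
          _ = c * 1 * ε * (4 * A * Real.exp α) := by ring
          _ ≤ c * k * ε * (4 * A * Real.exp α + 1 / α) := by
            have : 0 ≤ 1 / α := by positivity
            gcongr
            linarith
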